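/- Let $a\in[\tfrac{2\pi}{5},\tfrac{\pi}{2})$ and let $q,p\in L_2(0,\pi)$ be complex-valued functions vanishing almost everywhere on $(0,a)$. Consider the Dirac-type system with constant delay $$By'(x)+Q(x)y(x-a)=\lambda y(x),\quad 0<x<\pi,\qquad B=\begin{bmatrix}0&1\\-1&0\end{bmatrix},\quad Q(x)=\begin{bmatrix}q(x)&p(x)\\p(x)&-q(x)\end{bmatrix},\quad y(x)=\begin{bmatrix}y_1(x)\\y_2(x)\end{bmatrix},$$ whose solutions are absolutely continuous on $[0,\pi]$ and satisfy the equation almost everywhere. For $\nu,j\in\{1,2\}$ let $B_{\nu,j}(Q)$ be the boundary value problem for this system with the boundary conditions $y_\nu(0)=0$, $y_j(\pi)=0$; its eigenvalues are the $\lambda\in\mathbb{C}$ for which it has a solution that is not identically zero on $[0,\pi]$. Let $Y(x,\lambda)=[y_{k,l}(x,\lambda)]_{k,l=1,2}$ be the fundamental matrix-solution with $Y(0,\lambda)=I$, and let $\Delta_{\nu,j}(\lambda)=y_{j,3-\nu}(\pi,\lambda)$ be the characteristic function of $B_{\nu,j}(Q)$. Then $Y(\cdot,\lambda)$ exists for every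 $\lambda\in\mathbb{C}$, $\Delta_{\nu,j}$ is entire, and for all $\nu,j\in\{1,2\}$ the problem $B_{\nu,j}(Q)$ has infinitely many eigenvalues. All of them, each repeated according to its multiplicity as a zero of $\Delta_{\nu,j}$, can be numbered as $\lambda_{n,\nu,j}$, $n\in\mathbb{Z}$, so that $$\lambda_{n,\nu,j}=n+\frac{2-\nu-j}{2}+\kappa_{n,\nu,j},\qquad \{\kappa_{n,\nu,j}\}_{n\in\mathbb{Z}}\in l_2.$$ -/

import Mathlib

open MeasureTheory Set

noncomputable section

namespace DiracDelay

/-- The constant matrix `B` of the Dirac system. -/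
def B : Matrix (Fin 2) (Fin 2) ℂ := !![0, 1; -1, 0]

/-- The potential matrix `Q(x)` built from the two complex potentials `q` and `p`. -/
def Q (q p : ℝ → ℂ) (x : ℝ) : Matrix (Fin 2) (Fin 2) ℂ := !![q x, p x; p x, -q x]

/-- Admissible potentials: `f ∈ L₂(0, π)` (complex-valued) and `f = 0` almost everywhere
on `(0, a)`. -/
def IsPotential (a : ℝ) (f : ℝ → ℂ) : Prop :=
  MemLp f 2 (volume.restrict (Ioo 0 Real.pi)) ∧ ∀ᵐ x ∂(volume.restrict (Ioo 0 a)), f x = 0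

/-- `y` is a solution of `B y'(x) + Q(x) y(x - a) = z y(x)` on `(0, π)`: it is absolutely
continuous on `[0, π]` and satisfies the equation almost everywhere on `(0, π)`.
For `x < a` the values of `y` to the left of `0` occur only multiplied by `Q(x) = 0`. -/
def IsSolution (a : ℝ) (q p : ℝ → ℂ) (z : ℂ) (y : ℝ → Fin 2 → ℂ) : Prop :=
  AbsolutelyContinuousOnInterval y 0 Real.pi ∧
  ∀ᵐ x ∂(volume.restrict (Ioo 0 Real.pi)), ∃ y' : Fin 2 → ℂ, HasDerivAt y y' x ∧
    B.mulVec y' + (Q q p x).mulVec (y (x - a)) = z • y x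

/-- `z` is an eigenvalue of the boundary value problem with the boundary conditions
`y_ν(0) = 0`, `y_j(π) = 0`: there is a solution that satisfies them and is not identically
zero on `[0, π]`. The components `1, 2` are indexed by `0, 1 : Fin 2`. -/
def IsEigenvalue (a : ℝ) (q p : ℝ → ℂ) (ν j : Fin 2) (z : ℂ) : Prop :=
  ∃ y : ℝ → Fin 2 → ℂ, IsSolution a q p z y ∧ y 0 ν = 0 ∧ y Real.pi j = 0 ∧
    ∃ x ∈ Icc 0 Real.pi, y x ≠ 0

/-- `Y` is a fundamental matrix-solution: each column is a solution and `Y(0)` is the identity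
matrix. (It is unique on `[0, π]`.) -/
def IsFundamentalMatrix (a : ℝ) (q p : ℝ → ℂ) (z : ℂ)
    (Y : ℝ → Matrix (Fin 2) (Fin 2) ℂ) : Prop :=
  (∀ k : Fin 2, IsSolution a q p z (fun x i => Y x i k)) ∧ Y 0 = 1

/-- `Δ` is the characteristic function: `Δ(z) = y_{j, 3-ν}(π, z)`, an entry of the fundamental
matrix-solution at `x = π`. In terms of `Fin 2`, passing from `ν` to `3 - ν` is `Fin.rev`. -/
def IsCharacteristicFunction (a : ℝ) (q p : ℝ → ℂ) (ν j : Fin 2) (Δ : ℂ → ℂ) : Prop :=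
  ∀ z : ℂ, ∃ Y : ℝ → Matrix (Fin 2) (Fin 2) ℂ,
    IsFundamentalMatrix a q p z Y ∧ Δ z = Y Real.pi j ν.rev

end DiracDelay

end

/-! With `u = y₁ + i y₂` and `v = y₁ - i y₂` the system becomes `u' = izu + (p - iq) v(x - a)`, `v'
= -izv + (p + iq) u(x - a)`. The potentials live on `(a, π]`, and `π < 3a`, so the iteration of the
integral equations stops after two delays and the solution is explicit (`diagSol`).

At `x = π` the zero-delay term is a free exponential of type `π`. The other two are Fourier
integrals of `L₂` functions with frequencies in a strictly smaller band
(`isSineRemainder_fourierIntegral`, `isSineRemainder_iterated`): they are entire of type less than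
`π`, and Parseval makes them square-summable along translates of `ℤ`. After a shift and a change of
sign each characteristic function is therefore `sin (πz) + g(z)` with such a `g`
(`exists_fundMatrix_pi_eq`).

Away from the integers `g` is eventually dominated by the sine, so Rouché's theorem locates the
zeros: as many as the sine has in a large disc, and exactly one near each integer outside it.
Comparing `sin (πz)` with `g` at such a zero gives `‖κ n‖ ≤ ‖g n‖`, hence `κ ∈ l₂`
(`exists_zero_enumeration`). Uniqueness for the Cauchy problem identifies eigenvalues with zeros of
the characteristic function (`isEigenvalue_iff`). -/

open MeasureTheory Set

noncomputable section

namespace DiracDelay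

/-! ### Argument principle and Rouché's theorem for entire functions. -/

/-- The number of zeros of `f` in the open disc `ball c R`, counted with multiplicity. -/
def zeroCount (f : ℂ → ℂ) (c : ℂ) (R : ℝ) : ℕ :=
  ∑ᶠ z ∈ Metric.ball c R, analyticOrderNatAt f z

theorem finite_zeros_inter_closedBall {f : ℂ → ℂ} (hf : Differentiable ℂ f) {w : ℂ}
    (hw : f w ≠ 0) (c : ℂ) (R : ℝ) : (Metric.closedBall c R ∩ {z | f z = 0}).Finite := by
  have hcod := AnalyticOnNhd.preimage_zero_mem_codiscrete
    (fun z _ => hf.analyticAt z : AnalyticOnNhd ℂ f univ) hw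
  have h2 : IsClosed (f ⁻¹' {0}ᶜ)ᶜ ∧ IsDiscrete (f ⁻¹' {0}ᶜ)ᶜ := by
    simpa using mem_codiscrete'.1 hcod
  have h3 : {z | f z = 0} = (f ⁻¹' {0}ᶜ)ᶜ := by ext; simp
  rw [h3]
  refine IsCompact.finite ((isCompact_closedBall c R).inter_right h2.1) ?_
  exact h2.2.mono inter_subset_right

theorem analyticOrderNatAt_support {f : ℂ → ℂ} (hf : Differentiable ℂ f) :
    Function.support (analyticOrderNatAt f) ⊆ {z | f z = 0} := by
  intro z hz
  by_contra h
  apply hz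
  have : analyticOrderAt f z = 0 := (hf.analyticAt z).analyticOrderAt_eq_zero.2 h
  simp [analyticOrderNatAt, this]

/-- `zeroCount` is a `finsum`, which is `0` by default on infinite support; this finiteness makes it
a genuine count. -/
theorem finite_ball_inter_support {f : ℂ → ℂ} (hf : Differentiable ℂ f) {w : ℂ}
    (hw : f w ≠ 0) (c : ℂ) (R : ℝ) :
    (Metric.ball c R ∩ Function.support (analyticOrderNatAt f)).Finite :=
  (finite_zeros_inter_closedBall hf hw c R).subset
    (inter_subset_inter Metric.ball_subset_closedBall (analyticOrderNatAt_support hf))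

theorem analyticOrderAt_ne_top_of_ne_zero {f : ℂ → ℂ} (hf : Differentiable ℂ f) {w : ℂ}
    (hw : f w ≠ 0) (z : ℂ) : analyticOrderAt f z ≠ ⊤ := by
  refine AnalyticOnNhd.analyticOrderAt_ne_top_of_isPreconnected
    (fun z _ => hf.analyticAt z : AnalyticOnNhd ℂ f univ) isPreconnected_univ (mem_univ w)
    (mem_univ z) ?_
  rw [(hf.analyticAt w).analyticOrderAt_eq_zero.2 hw]
  simp

theorem analyticOrderNatAt_ne_zero_iff {f : ℂ → ℂ} (hf : Differentiable ℂ f) {w : ℂ}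
    (hw : f w ≠ 0) (z : ℂ) : analyticOrderNatAt f z ≠ 0 ↔ f z = 0 := by
  rw [← Nat.cast_ne_zero (R := ℕ∞),
    Nat.cast_analyticOrderNatAt (analyticOrderAt_ne_top_of_ne_zero hf hw z),
    (hf.analyticAt z).analyticOrderAt_ne_zero]

theorem zeroCount_mul_linear {h : ℂ → ℂ} (hh : Differentiable ℂ h) {w : ℂ} (hw : h w ≠ 0)
    {a c : ℂ} {R : ℝ} (ha : a ∈ Metric.ball c R) :
    zeroCount (fun z => (z - a) * h z) c R = zeroCount h c R + 1 := by
  classical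
  have key : ∀ z, analyticOrderNatAt (fun z => (z - a) * h z) z
      = analyticOrderNatAt h z + if z = a then 1 else 0 := by
    intro z
    have hl : AnalyticAt ℂ (fun z : ℂ => z - a) z := by fun_prop
    have hl' : analyticOrderAt (fun z : ℂ => z - a) z = if z = a then 1 else 0 := by
      split_ifs with hz
      · subst hz; exact analyticOrderAt_id_sub_const_self
      · exact analyticOrderAt_id_sub_const_of_ne hz
    have h1 := analyticOrderNatAt_mul hl (hh.analyticAt z)
      (by rw [hl']; split_ifs <;> simp) (analyticOrderAt_ne_top_of_ne_zero hh hw z)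
    have h2 : analyticOrderNatAt (fun z : ℂ => z - a) z = if z = a then 1 else 0 := by
      rw [analyticOrderNatAt, hl']; split_ifs <;> simp
    rw [h2] at h1
    rw [add_comm]
    exact h1
  unfold zeroCount
  simp_rw [key]
  rw [finsum_mem_add_distrib' (finite_ball_inter_support hh hw c R)]
  · congr 1
    rw [finsum_eq_single _ a fun b hb => by simp [hb]]
    simp [ha]
  · refine (finite_singleton a).subset ?_
    rintro z ⟨_, hz⟩
    simpa using hz

/-- The argument principle for entire functions. -/
theorem circleIntegral_logDeriv {f : ℂ → ℂ} (hf : Differentiable ℂ f) {c : ℂ} {R : ℝ}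
    (hR : 0 < R) (h0 : ∀ z ∈ Metric.sphere c R, f z ≠ 0) :
    (∮ z in C(c, R), logDeriv f z) = 2 * Real.pi * Complex.I * zeroCount f c R := by
  obtain ⟨w, hw⟩ : (Metric.sphere c R).Nonempty := NormedSpace.sphere_nonempty.2 hR.le
  generalize hn : zeroCount f c R = n
  -- Induction on the number of zeros: without zeros `logDeriv f` is holomorphic and Cauchy's
  -- theorem applies; otherwise one zero is divided out and contributes `2πi`.
  induction n generalizing f with
  | zero =>
    have hne : ∀ z ∈ Metric.closedBall c R, f z ≠ 0 := by
      intro z hz hfz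
      by_cases hs : z ∈ Metric.sphere c R
      · exact h0 z hs hfz
      have hzb : z ∈ Metric.ball c R := by
        rw [← Metric.closedBall_sdiff_sphere]; exact ⟨hz, hs⟩
      rw [zeroCount, finsum_mem_eq_sum _
        (finite_ball_inter_support hf (h0 w hw) c R), Finset.sum_eq_zero_iff] at hn
      have hz0 := (analyticOrderNatAt_ne_zero_iff hf (h0 w hw) z).2 hfz
      exact hz0 (hn z (by simpa using ⟨hzb, hz0⟩))
    simp only [Nat.cast_zero, mul_zero]
    have hd : ∀ z ∈ Metric.closedBall c R, DifferentiableAt ℂ (logDeriv f) z := by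
      intro z hz
      exact (hf.analyticAt z).deriv.differentiableAt.div (hf z) (hne z hz)
    exact Complex.circleIntegral_eq_zero_of_differentiable_on_off_countable hR.le
      countable_empty (fun z hz => (hd z hz).continuousAt.continuousWithinAt)
      (fun z hz => hd z (Metric.ball_subset_closedBall hz.1))
  | succ n ih =>
    obtain ⟨a, hab, ha⟩ : ∃ a ∈ Metric.ball c R, f a = 0 := by
      by_contra! hcon
      have : zeroCount f c R = 0 := by
        unfold zeroCount
        refine finsum_mem_eq_zero_of_forall_eq_zero fun z hz => ?_
        by_contra hz0
        exact hcon z hz ((analyticOrderNatAt_ne_zero_iff hf (h0 w hw) z).1 hz0)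
      omega
    -- The quotient `f z / (z - a)`, extended by `deriv f a` at `a`, is again entire.
    set h := dslope f a with hh
    have hhd : Differentiable ℂ h := by
      rw [← differentiableOn_univ, hh, Complex.differentiableOn_dslope Filter.univ_mem]
      exact hf.differentiableOn
    have hfh : f = fun z => (z - a) * h z := by
      ext z
      have := sub_smul_dslope f a z
      rw [ha, sub_zero] at this
      simpa [hh] using this.symm
    have hne : ∀ z ∈ Metric.sphere c R, h z ≠ 0 ∧ z - a ≠ 0 := by
      intro z hz
      have := h0 z hz
      rw [hfh] at this
      exact ⟨right_ne_zero_of_mul this, left_ne_zero_of_mul this⟩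
    have hcount : zeroCount h c R = n := by
      have h2 := zeroCount_mul_linear hhd (hne w hw).1 hab
      rw [← hfh] at h2
      omega
    have hint := ih hhd (fun z hz => (hne z hz).1) hcount
    have heq : ∀ z ∈ Metric.sphere c R, logDeriv f z = (z - a)⁻¹ + logDeriv h z := by
      intro z hz
      rw [hfh, logDeriv_mul z (hne z hz).2 (hne z hz).1 (by fun_prop) (hhd z)]
      congr 1
      simp [logDeriv_apply]
    rw [circleIntegral.integral_congr hR.le heq, circleIntegral.integral_add, hint,
      circleIntegral.integral_sub_inv_of_mem_ball hab]
    · push_cast; ring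
    · refine ContinuousOn.circleIntegrable hR.le ?_
      exact ContinuousOn.inv₀ (by fun_prop) fun z hz => (hne z hz).2
    · refine ContinuousOn.circleIntegrable hR.le ?_
      exact ContinuousOn.div (fun z _ => (hhd.analyticAt z).deriv.continuousAt.continuousWithinAt)
        hhd.continuous.continuousOn fun z hz => (hne z hz).1

/-- Rouché's theorem for entire functions. -/
theorem zeroCount_add_eq {f g : ℂ → ℂ} (hf : Differentiable ℂ f) (hg : Differentiable ℂ g)
    {c : ℂ} {R : ℝ} (hR : 0 < R) (hlt : ∀ z ∈ Metric.sphere c R, ‖g z‖ < ‖f z‖) :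
    zeroCount (fun z => f z + g z) c R = zeroCount f c R := by
  have hf0 : ∀ z ∈ Metric.sphere c R, f z ≠ 0 := fun z hz h => by
    have := hlt z hz
    rw [h, norm_zero] at this
    exact absurd this (norm_nonneg _).not_gt
  have hfg0 : ∀ z ∈ Metric.sphere c R, f z + g z ≠ 0 := fun z hz h => by
    have := hlt z hz
    rw [eq_neg_of_add_eq_zero_left h, norm_neg] at this
    exact lt_irrefl _ this
  have hfgd : Differentiable ℂ (fun z => f z + g z) := hf.add hg
  have h1 := circleIntegral_logDeriv hfgd hR hfg0
  have h2 := circleIntegral_logDeriv hf hR hf0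
  -- `‖g / f‖ < 1` keeps `(f + g) / f` off the branch cut, so its principal logarithm is a
  -- primitive, along the circle, of the difference of the logarithmic derivatives.
  have hslit : ∀ z ∈ Metric.sphere c R, 1 + g z / f z ∈ Complex.slitPlane := by
    intro z hz
    apply Complex.mem_slitPlane_of_norm_lt_one
    rw [norm_div, div_lt_one (norm_pos_iff.2 (hf0 z hz))]
    exact hlt z hz
  have h3 : (∮ z in C(c, R), (logDeriv (fun z => f z + g z) z - logDeriv f z)) = 0 := by
    refine circleIntegral.integral_eq_zero_of_hasDerivWithinAt hR.le
      (f := fun z => Complex.log (1 + g z / f z)) fun z hz => HasDerivAt.hasDerivWithinAt ?_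
    have hd := (((hg z).hasDerivAt.div (hf z).hasDerivAt (hf0 z hz)).const_add 1).clog
      (hslit z hz)
    refine HasDerivAt.congr_deriv hd ?_
    have := hf0 z hz
    have := hfg0 z hz
    have h4 : 1 + (g / f) z = (f z + g z) / f z := by
      simp only [Pi.div_apply]; field_simp
    rw [h4, logDeriv_apply, logDeriv_apply, deriv_fun_add (hf z) (hg z)]
    field_simp
    ring
  have hci : ∀ k : ℂ → ℂ, Differentiable ℂ k → (∀ z ∈ Metric.sphere c R, k z ≠ 0) →
      CircleIntegrable (logDeriv k) c R := fun k hk hk0 =>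
    (ContinuousOn.div (fun z _ => (hk.analyticAt z).deriv.continuousAt.continuousWithinAt)
      hk.continuous.continuousOn hk0).circleIntegrable hR.le
  rw [circleIntegral.integral_sub (hci _ hfgd hfg0) (hci _ hf hf0), h1, h2, ← mul_sub] at h3
  have h5 : (2 * Real.pi * Complex.I : ℂ) ≠ 0 := Complex.two_pi_I_ne_zero
  have h6 := sub_eq_zero.1 ((mul_eq_zero.1 h3).resolve_left h5)
  exact_mod_cast h6

/-! ### Lower bounds for `sin (πz)`. -/

theorem norm_sq_sin (z : ℂ) :
    ‖Complex.sin z‖ ^ 2 = Real.sin z.re ^ 2 + Real.sinh z.im ^ 2 := by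
  rw [Complex.sin_eq, ← Complex.ofReal_sin, ← Complex.ofReal_cos, ← Complex.ofReal_sinh,
    ← Complex.ofReal_cosh, ← Complex.ofReal_mul, ← Complex.ofReal_mul, Complex.sq_norm,
    Complex.normSq_add_mul_I]
  have h1 := Real.sin_sq_add_cos_sq z.re
  have h2 := Real.cosh_sq z.im
  linear_combination (Real.sinh z.im ^ 2) * h1 + (Real.sin z.re ^ 2) * h2

theorem norm_sin_pi_sub_int (z : ℂ) (n : ℤ) :
    ‖Complex.sin (Real.pi * (z - n))‖ = ‖Complex.sin (Real.pi * z)‖ := by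
  rw [mul_sub, mul_comm (Real.pi : ℂ) n, Complex.sin_antiperiodic.sub_int_mul_eq]
  rcases Int.even_or_odd n with h | h
  · simp [Int.negOnePow_even n h]
  · simp [Int.negOnePow_odd n h]

theorem sq_le_sin_pi_sq {x : ℝ} (hx : |x| ≤ 1 / 2) :
    4 * x ^ 2 ≤ Real.sin (Real.pi * x) ^ 2 := by
  have h := Real.mul_le_sin (x := Real.pi * |x|) (by positivity)
    (by nlinarith [Real.pi_pos])
  have h1 : 2 / Real.pi * (Real.pi * |x|) = 2 * |x| := by
    field_simp
  rw [h1] at h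
  have h2 : Real.sin (Real.pi * |x|) ^ 2 = Real.sin (Real.pi * x) ^ 2 := by
    rcases abs_cases x with ⟨h, _⟩ | ⟨h, _⟩ <;> rw [h]
    rw [mul_neg, Real.sin_neg, neg_sq]
  rw [← h2, ← sq_abs x]
  nlinarith [abs_nonneg x]

theorem sq_le_sinh_sq (y : ℝ) : y ^ 2 ≤ Real.sinh y ^ 2 := by
  rw [sq_le_sq, Real.abs_sinh]
  exact Real.self_le_sinh_iff.2 (abs_nonneg y)

/-- Jordan's inequality controls the real part, `|sinh y| ≥ |y|` the imaginary part. The constant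
`2` later beats the Lipschitz constant `1` of the remainder. -/
theorem two_mul_norm_le_norm_sin_pi {z : ℂ} (hz : |z.re| ≤ 1 / 2) :
    2 * ‖z‖ ≤ ‖Complex.sin (Real.pi * z)‖ := by
  refine le_of_sq_le_sq ?_ (norm_nonneg _)
  rw [norm_sq_sin, mul_pow, Complex.sq_norm, Complex.normSq_apply]
  have h1 := sq_le_sin_pi_sq hz
  have h2 := sq_le_sinh_sq (Real.pi * z.im)
  have h3 : 4 * z.im ^ 2 ≤ (Real.pi * z.im) ^ 2 := by
    rw [mul_pow]
    have := Real.pi_gt_three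
    gcongr
    nlinarith
  simp only [Complex.re_ofReal_mul, Complex.im_ofReal_mul]
  nlinarith

/-- Near the real axis the exponential is at most `3` and the distance to the nearest integer gives
`1/2 ≥ 3/8`; elsewhere `|sinh (π Im z)|` already suffices. -/
theorem exp_le_norm_sin_pi {z : ℂ} (hz : ∀ n : ℤ, 1 / 4 ≤ ‖z - n‖) :
    1 / 8 * Real.exp (Real.pi * |z.im|) ≤ ‖Complex.sin (Real.pi * z)‖ := by
  rcases le_total (Real.pi * |z.im|) 1 with h | h
  · have h1 : Real.exp (Real.pi * |z.im|) ≤ 3 :=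
      (Real.exp_le_exp.2 h).trans (Real.exp_one_lt_d9.le.trans (by norm_num))
    have h2 := two_mul_norm_le_norm_sin_pi (z := z - round z.re)
      (by simpa using abs_sub_round z.re)
    rw [norm_sin_pi_sub_int] at h2
    linarith [hz (round z.re)]
  · have h1 : |Real.sinh (Real.pi * z.im)| ≤ ‖Complex.sin (Real.pi * z)‖ := by
      refine le_of_sq_le_sq ?_ (norm_nonneg _)
      rw [norm_sq_sin, sq_abs]
      simp only [Complex.re_ofReal_mul, Complex.im_ofReal_mul]
      nlinarith [sq_nonneg (Real.sin (Real.pi * z.re))]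
    refine le_trans ?_ h1
    rw [Real.abs_sinh, abs_mul, abs_of_pos Real.pi_pos, Real.sinh_eq]
    set t := Real.pi * |z.im|
    have h2 : 2 ≤ Real.exp t := by linarith [Real.add_one_le_exp t]
    have h3 : Real.exp (-t) ≤ 1 := Real.exp_le_one_iff.2 (by linarith)
    linarith

/-! ### Decay of sine remainders. -/

/-- Entire functions of exponential type less than `π` that are square-summable along every
translate of the integers. -/
structure IsSineRemainder (g : ℂ → ℂ) : Prop where
  differentiable : Differentiable ℂ g
  norm_le : ∃ C b : ℝ, b < Real.pi ∧ ∀ z, ‖g z‖ ≤ C * Real.exp (b * |z.im|)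
  summable : ∀ c : ℂ, Summable fun n : ℤ => ‖g (n + c)‖ ^ 2

namespace IsSineRemainder

variable {g : ℂ → ℂ}

theorem exists_norm_deriv_le (hg : IsSineRemainder g) (K : ℝ) :
    ∃ D, 0 < D ∧ ∀ z : ℂ, |z.im| ≤ K → ‖deriv g z‖ ≤ D := by
  obtain ⟨C, b, -, hb⟩ := hg.norm_le
  have hC : 0 ≤ C := by
    have := (norm_nonneg _).trans (hb 0)
    simpa using this
  -- Cauchy's estimate on unit circles, which reach height at most `K + 1`; the final `+ 1` only
  -- makes the bound positive.
  refine ⟨C * Real.exp (|b| * (K + 1)) + 1, by positivity, fun z hz => ?_⟩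
  have := Complex.norm_deriv_le_of_forall_mem_sphere_norm_le (c := z) (R := 1) (f := g)
    (C := C * Real.exp (|b| * (K + 1))) one_pos hg.differentiable.diffContOnCl ?_
  · linarith
  intro w hw
  refine (hb w).trans ?_
  have h1 : |w.im| ≤ K + 1 := by
    have h2 : |(w - z).im| ≤ 1 := (Complex.abs_im_le_norm _).trans (mem_sphere_iff_norm.1 hw).le
    rw [Complex.sub_im] at h2
    have := abs_sub_abs_le_abs_sub w.im z.im
    linarith
  gcongr
  exact le_abs_self b

/-- Summability gives decay along each `n + ζ`; the derivative bound, uniform in the strip, makes it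
locally uniform in `ζ`, and compactness does the rest. -/
theorem eventually_norm_le_of_compact (hg : IsSineRemainder g) {S : Set ℂ} (hS : IsCompact S)
    {ε : ℝ} (hε : 0 < ε) : ∀ᶠ n : ℤ in Filter.cofinite, ∀ ζ ∈ S, ‖g (n + ζ)‖ ≤ ε := by
  obtain ⟨K, hK⟩ : ∃ K, ∀ ζ ∈ S, |ζ.im| ≤ K := by
    obtain ⟨K, hK⟩ := hS.isBounded.exists_norm_le
    exact ⟨K, fun ζ h => (Complex.abs_im_le_norm ζ).trans (hK ζ h)⟩
  obtain ⟨D, hD, hDb⟩ := hg.exists_norm_deriv_le (K + 1)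
  refine hS.induction_on (p := fun s => ∀ᶠ n : ℤ in Filter.cofinite, ∀ ζ ∈ s, ‖g (n + ζ)‖ ≤ ε)
    (by simp) (fun s t hst h => h.mono fun n hn ζ hζ => hn ζ (hst hζ)) ?_ ?_
  · intro s t hs ht
    filter_upwards [hs, ht] with n h1 h2 ζ hζ
    exact hζ.elim (h1 ζ) (h2 ζ)
  · intro ζ hζ
    -- Radius `1` stays in the strip of height `K + 1`; radius `ε / (2D)` lets `g` vary by at most
    -- `ε / 2`.
    have hd : 0 < min 1 (ε / (2 * D)) := by positivity
    refine ⟨Metric.ball ζ (min 1 (ε / (2 * D))),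
      mem_nhdsWithin_of_mem_nhds (Metric.ball_mem_nhds _ hd), ?_⟩
    have hlim : Filter.Tendsto (fun n : ℤ => ‖g (n + ζ)‖) Filter.cofinite (nhds 0) := by
      have h1 := (hg.summable ζ).tendsto_cofinite_zero
      have h2 := (Real.continuous_sqrt.tendsto 0).comp h1
      simpa [Function.comp_def] using h2
    filter_upwards [hlim.eventually (gt_mem_nhds (half_pos hε))] with n hn w hw
    have hw' : ‖w - ζ‖ < min 1 (ε / (2 * D)) := by simpa [dist_eq_norm] using hw
    have hsub : ‖g (n + w) - g (n + ζ)‖ ≤ D * ‖(n + w : ℂ) - (n + ζ)‖ := by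
      refine (convex_ball ((n : ℂ) + ζ) 1).norm_image_sub_le_of_norm_deriv_le
        (𝕜 := ℂ) (fun x _ => hg.differentiable x) (fun x hx => hDb x ?_)
        (Metric.mem_ball_self one_pos) ?_
      · have h1 : ‖x - (n + ζ)‖ < 1 := by simpa [dist_eq_norm] using hx
        have h2 : |(x - (n + ζ)).im| ≤ 1 := (Complex.abs_im_le_norm _).trans h1.le
        simp only [Complex.sub_im, Complex.add_im, Complex.intCast_im, zero_add] at h2
        have := abs_sub_abs_le_abs_sub x.im ζ.im
        linarith [hK ζ hζ]
      · rw [Metric.mem_ball, dist_eq_norm, add_sub_add_left_eq_sub]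
        exact hw'.trans_le (min_le_left _ _)
    rw [add_sub_add_left_eq_sub] at hsub
    have h3 : D * ‖w - ζ‖ ≤ ε / 2 := by
      have : ‖w - ζ‖ ≤ ε / (2 * D) := hw'.le.trans (min_le_right _ _)
      calc D * ‖w - ζ‖ ≤ D * (ε / (2 * D)) := by gcongr
        _ = ε / 2 := by field_simp
    have h4 := norm_sub_norm_le (g (n + w)) (g (n + ζ))
    linarith

theorem exists_norm_le_of_strip (hg : IsSineRemainder g) (K : ℝ) {ε : ℝ} (hε : 0 < ε) :
    ∃ M : ℕ, ∀ z : ℂ, |z.im| ≤ K → M ≤ |z.re| → ‖g z‖ ≤ ε := by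
  -- The integer translates of this rectangle cover the strip.
  have hS : IsCompact (Icc (0 : ℝ) 1 ×ℂ Icc (-K) K) := isCompact_Icc.reProdIm isCompact_Icc
  have hev := hg.eventually_norm_le_of_compact hS hε
  rw [Filter.eventually_cofinite] at hev
  obtain ⟨M, hM⟩ := (hev.image Int.natAbs).bddAbove
  refine ⟨M + 2, fun z hz hre => ?_⟩
  by_contra hcon
  have hmem : ⌊z.re⌋ ∈ {n : ℤ | ¬∀ ζ ∈ Icc (0 : ℝ) 1 ×ℂ Icc (-K) K, ‖g (n + ζ)‖ ≤ ε} := by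
    intro h
    apply hcon
    have h1 := h (z - ⌊z.re⌋) ?_
    · rwa [add_sub_cancel] at h1
    · rw [Complex.mem_reProdIm]
      simp only [Complex.sub_re, Complex.intCast_re, Complex.sub_im, Complex.intCast_im, sub_zero]
      exact ⟨⟨by linarith [Int.floor_le z.re], by linarith [Int.lt_floor_add_one z.re]⟩,
        abs_le.1 hz⟩
  have h2 : (⌊z.re⌋.natAbs : ℕ) ≤ M := hM (mem_image_of_mem _ hmem)
  have h3 : |(⌊z.re⌋ : ℝ)| ≤ M := by
    rw [← Int.cast_abs, Int.abs_eq_natAbs]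
    exact_mod_cast h2
  have h4 : |z.re| ≤ |(⌊z.re⌋ : ℝ)| + 1 := by
    have h5 : |z.re - ⌊z.re⌋| ≤ 1 := by
      rw [abs_le]
      exact ⟨by linarith [Int.floor_le z.re], by linarith [Int.lt_floor_add_one z.re]⟩
    have := abs_sub_abs_le_abs_sub z.re ⌊z.re⌋
    linarith
  push_cast at hre
  linarith

theorem exists_norm_le_exp (hg : IsSineRemainder g) {ε : ℝ} (hε : 0 < ε) :
    ∃ M : ℕ, ∀ z : ℂ, M ≤ ‖z‖ → ‖g z‖ ≤ ε * Real.exp (Real.pi * |z.im|) := by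
  obtain ⟨C, b, hbπ, hb⟩ := hg.norm_le
  -- Above height `K` the gap `π - b` between the types absorbs `C / ε`, since `t ≤ e^t`; below it
  -- the decay in strips applies.
  set K := C / ε / (Real.pi - b) with hK
  obtain ⟨M, hM⟩ := hg.exists_norm_le_of_strip K hε
  refine ⟨M + ⌈K⌉₊, fun z hz => ?_⟩
  rcases le_total |z.im| K with h | h
  · have h1 := hM z h ?_
    · refine h1.trans (le_mul_of_one_le_right hε.le (Real.one_le_exp ?_))
      positivity
    · push_cast at hz
      have := Complex.norm_le_abs_re_add_abs_im z
      linarith [Nat.le_ceil K]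
  · refine (hb z).trans ?_
    have hpos : 0 < Real.pi - b := sub_pos.2 hbπ
    have h1 : C / ε ≤ (Real.pi - b) * |z.im| := by
      rw [hK, div_le_iff₀ hpos] at h
      linarith
    have h2 : C ≤ ε * Real.exp ((Real.pi - b) * |z.im|) := by
      rw [← div_le_iff₀' hε]
      linarith [Real.add_one_le_exp ((Real.pi - b) * |z.im|)]
    calc C * Real.exp (b * |z.im|)
        ≤ ε * Real.exp ((Real.pi - b) * |z.im|) * Real.exp (b * |z.im|) := by gcongr
      _ = ε * Real.exp (Real.pi * |z.im|) := by
        rw [mul_assoc, ← Real.exp_add]; ring_nf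

end IsSineRemainder

/-! ### Counting and enumerating the zeros of `sin (πz) + g(z)`. -/

theorem differentiable_sin_pi : Differentiable ℂ fun z : ℂ => Complex.sin (Real.pi * z) := by
  fun_prop

theorem sin_pi_eq_zero_iff (z : ℂ) : Complex.sin (Real.pi * z) = 0 ↔ ∃ n : ℤ, z = n := by
  rw [Complex.sin_eq_zero_iff]
  have : (Real.pi : ℂ) ≠ 0 := by exact_mod_cast Real.pi_ne_zero
  refine exists_congr fun n => ?_
  rw [mul_comm (n : ℂ), mul_right_inj' this]

open Classical in
theorem analyticOrderNatAt_sin_pi (z : ℂ) :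
    analyticOrderNatAt (fun z : ℂ => Complex.sin (Real.pi * z)) z
      = if ∃ n : ℤ, z = n then 1 else 0 := by
  have ha := differentiable_sin_pi.analyticAt z
  split_ifs with h
  · have hz : Complex.sin (Real.pi * z) = 0 := (sin_pi_eq_zero_iff z).2 h
    have hd : deriv (fun z : ℂ => Complex.sin (Real.pi * z)) z ≠ 0 := by
      have h1 : HasDerivAt (fun z : ℂ => Complex.sin (Real.pi * z))
          (Complex.cos (Real.pi * z) * (Real.pi * 1)) z :=
        ((hasDerivAt_id z).const_mul (Real.pi : ℂ)).csin
      rw [h1.deriv]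
      have h2 := Complex.sin_sq_add_cos_sq (Real.pi * z)
      rw [hz] at h2
      have h3 : (Real.pi : ℂ) ≠ 0 := by exact_mod_cast Real.pi_ne_zero
      refine mul_ne_zero (fun h4 => ?_) (by simp)
      rw [h4] at h2
      norm_num at h2
    have h5 := ha.analyticOrderAt_sub_eq_one_of_deriv_ne_zero hd
    simp only [hz, sub_zero] at h5
    rw [analyticOrderNatAt, h5]
    rfl
  · have : analyticOrderAt (fun z : ℂ => Complex.sin (Real.pi * z)) z = 0 :=
      ha.analyticOrderAt_eq_zero.2 fun h0 => h ((sin_pi_eq_zero_iff z).1 h0)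
    rw [analyticOrderNatAt, this]
    rfl

theorem zeroCount_sin_pi {c : ℂ} {R : ℝ} (s : Finset ℤ)
    (hs : ∀ n : ℤ, n ∈ s ↔ (n : ℂ) ∈ Metric.ball c R) :
    zeroCount (fun z : ℂ => Complex.sin (Real.pi * z)) c R = s.card := by
  classical
  unfold zeroCount
  simp_rw [analyticOrderNatAt_sin_pi]
  rw [finsum_mem_eq_sum_of_inter_support_eq (t := s.image (fun n : ℤ => (n : ℂ)))]
  · rw [Finset.sum_image (fun _ _ _ _ h => by exact_mod_cast h)]
    simp
  · ext z
    simp only [mem_inter_iff, Function.mem_support, Finset.coe_image, mem_image, SetLike.mem_coe]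
    constructor
    · rintro ⟨hz, h⟩
      obtain ⟨n, rfl⟩ : ∃ n : ℤ, z = n := by
        by_contra hcon
        simp [hcon] at h
      exact ⟨⟨n, (hs n).2 hz, rfl⟩, h⟩
    · rintro ⟨⟨n, hn, rfl⟩, h⟩
      exact ⟨(hs n).1 hn, h⟩

theorem exists_unique_zero_of_zeroCount_eq_one {f : ℂ → ℂ} (hf : Differentiable ℂ f) {w c : ℂ}
    (hw : f w ≠ 0) {R : ℝ} (h1 : zeroCount f c R = 1) :
    ∃ z ∈ Metric.ball c R, analyticOrderNatAt f z = 1 ∧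
      ∀ x ∈ Metric.ball c R, f x = 0 → x = z := by
  classical
  rw [zeroCount, finsum_mem_eq_sum _ (finite_ball_inter_support hf hw c R)] at h1
  set T := (finite_ball_inter_support hf hw c R).toFinset with hT
  have hmem : ∀ z, z ∈ T ↔ z ∈ Metric.ball c R ∧ analyticOrderNatAt f z ≠ 0 := by
    intro z; simp [hT]
  obtain ⟨z, hz⟩ : T.Nonempty := by
    by_contra hcon
    rw [Finset.not_nonempty_iff_eq_empty] at hcon
    simp [hcon] at h1
  have hz' := (hmem z).1 hz
  rw [← Finset.add_sum_erase _ _ hz] at h1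
  refine ⟨z, hz'.1, by omega, fun x hx hfx => ?_⟩
  by_contra hxz
  have hx0 := (analyticOrderNatAt_ne_zero_iff hf hw x).2 hfx
  have hxT : x ∈ T.erase z := Finset.mem_erase.2 ⟨hxz, (hmem x).2 ⟨hx, hx0⟩⟩
  have := Finset.single_le_sum (f := analyticOrderNatAt f) (fun _ _ => Nat.zero_le _) hxT
  omega

/-- Pure combinatorics: indices are dealt out in blocks, `m z` of them to each `z`. It numbers the
zeros in the central disc, where no zero has a natural index. -/
theorem exists_enumeration {α ι : Type*} [DecidableEq α] [Nonempty α] (m : α → ℕ) (T : Finset α)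
    (s : Finset ι) (h : ∑ z ∈ T, m z = s.card) :
    ∃ e : ι → α, (∀ n ∈ s, e n ∈ T) ∧ ∀ z ∈ T, (s.filter fun n => e n = z).card = m z := by
  classical
  induction T using Finset.induction_on generalizing s with
  | empty =>
    have hs : s = ∅ := by rw [← Finset.card_eq_zero, ← h]; simp
    exact ⟨fun _ => Classical.arbitrary α, by simp [hs], by simp⟩
  | insert a T ha ih =>
    rw [Finset.sum_insert ha] at h
    obtain ⟨s₁, hs₁, hc⟩ := Finset.exists_subset_card_eq (s := s) (n := m a) (by omega)
    obtain ⟨e, he, hcard⟩ := ih (s \ s₁) (by rw [Finset.card_sdiff_of_subset hs₁]; omega)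
    refine ⟨fun n => if n ∈ s₁ then a else e n, fun n hn => ?_, fun z hz => ?_⟩
    · dsimp only
      split_ifs with h1
      · exact Finset.mem_insert_self _ _
      · exact Finset.mem_insert_of_mem (he n (Finset.mem_sdiff.2 ⟨hn, h1⟩))
    · rcases Finset.mem_insert.1 hz with rfl | hzT
      · rw [← hc]
        congr 1
        ext n
        simp only [Finset.mem_filter]
        refine ⟨fun ⟨hn, h1⟩ => ?_, fun hn => ⟨hs₁ hn, by simp [hn]⟩⟩
        by_contra h2
        rw [if_neg h2] at h1
        exact ha (h1 ▸ he n (Finset.mem_sdiff.2 ⟨hn, h2⟩))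
      · rw [← hcard z hzT]
        congr 1
        ext n
        simp only [Finset.mem_filter, Finset.mem_sdiff]
        have haz : a ≠ z := fun h => ha (h ▸ hzT)
        by_cases h2 : n ∈ s₁ <;> simp [h2, haz]

namespace IsSineRemainder

variable {g : ℂ → ℂ}

theorem exists_norm_lt_norm_sin (hg : IsSineRemainder g) :
    ∃ M : ℕ, ∀ z : ℂ, M ≤ ‖z‖ → (∀ n : ℤ, 1 / 4 ≤ ‖z - n‖) →
      ‖g z‖ < ‖Complex.sin (Real.pi * z)‖ := by
  obtain ⟨M, hM⟩ := hg.exists_norm_le_exp (ε := 1 / 16) (by norm_num)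
  refine ⟨M, fun z hz hn => ?_⟩
  have h1 := hM z hz
  have h2 := exp_le_norm_sin_pi hn
  have h3 := Real.exp_pos (Real.pi * |z.im|)
  linarith

theorem exists_norm_sub_le (hg : IsSineRemainder g) :
    ∃ M : ℕ, ∀ (n : ℤ) (ζ : ℂ), M ≤ |(n : ℝ)| → ‖ζ‖ ≤ 1 → ‖g (n + ζ) - g n‖ ≤ ‖ζ‖ := by
  -- Unit circles about points of the unit disc at `n` stay within distance `2` of `n`. There `‖g‖ ≤
  -- 1`, so Cauchy's estimate makes `g` 1-Lipschitz.
  obtain ⟨M, hM⟩ := hg.exists_norm_le_of_strip 2 one_pos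
  refine ⟨M + 2, fun n ζ hn hζ => ?_⟩
  have h := (convex_closedBall (n : ℂ) 1).norm_image_sub_le_of_norm_deriv_le (𝕜 := ℂ) (f := g)
    (C := 1) (x := n) (y := n + ζ) (fun x _ => hg.differentiable x) (fun x hx => ?_)
    (Metric.mem_closedBall_self zero_le_one) (by simpa using hζ)
  · simpa using h
  · have := Complex.norm_deriv_le_of_forall_mem_sphere_norm_le (c := x) (R := 1) (f := g)
      (C := 1) one_pos hg.differentiable.diffContOnCl fun w hw => ?_
    · simpa using this
    have h1 : ‖w - n‖ ≤ 2 := by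
      have h2 : ‖w - x‖ = 1 := mem_sphere_iff_norm.1 hw
      have h3 : ‖x - n‖ ≤ 1 := mem_closedBall_iff_norm.1 hx
      have := norm_sub_le_norm_sub_add_norm_sub w x n
      linarith
    apply hM
    · have := (Complex.abs_im_le_norm _).trans h1
      simpa using this
    · have h2 := (Complex.abs_re_le_norm _).trans h1
      simp only [Complex.sub_re, Complex.intCast_re] at h2
      have h3 := abs_sub_abs_le_abs_sub (n : ℝ) w.re
      rw [abs_sub_comm] at h3
      push_cast at hn
      linarith

end IsSineRemainder

theorem norm_int_complex (n : ℤ) : ‖(n : ℂ)‖ = |(n : ℝ)| := by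
  rw [← Complex.ofReal_intCast, Complex.norm_real, Real.norm_eq_abs]

theorem one_le_norm_int_sub {m n : ℤ} (h : m ≠ n) : 1 ≤ ‖(m : ℂ) - n‖ := by
  rw [← Int.cast_sub, norm_int_complex, ← Int.cast_abs]
  exact_mod_cast Int.one_le_abs (sub_ne_zero.2 h)

/-- The zeros of `sin (π z) + g z`, counted with multiplicity, can be enumerated as
`n + κ n` with a square-summable sequence `κ`; all multiplicities are finite. -/
theorem exists_zero_enumeration {f g : ℂ → ℂ} (hg : IsSineRemainder g)
    (hf : ∀ z, f z = Complex.sin (Real.pi * z) + g z) :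
    (∀ z : ℂ, analyticOrderAt f z ≠ ⊤) ∧
    ∃ lam κ : ℤ → ℂ, (∀ z : ℂ, {n : ℤ | lam n = z}.encard = analyticOrderAt f z) ∧
      (∀ n : ℤ, lam n = n + κ n) ∧ Memℓp κ 2 := by
  classical
  have hfe : f = fun z => Complex.sin (Real.pi * z) + g z := funext hf
  have hfd : Differentiable ℂ f := by
    rw [hfe]; exact differentiable_sin_pi.add hg.differentiable
  obtain ⟨M₁, hM₁⟩ := hg.exists_norm_lt_norm_sin
  obtain ⟨M₂, hM₂⟩ := hg.exists_norm_sub_le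
  set N : ℕ := max M₁ M₂ + 1 with hN
  have hN₁ : (M₁ : ℝ) + 1 ≤ N := by
    rw [hN]; exact_mod_cast Nat.succ_le_succ (le_max_left _ _)
  have hN₂ : (M₂ : ℝ) + 1 ≤ N := by
    rw [hN]; exact_mod_cast Nat.succ_le_succ (le_max_right _ _)
  have hM₁0 : (0 : ℝ) ≤ M₁ := Nat.cast_nonneg _
  -- the remainder is dominated by the sine on all the circles used below
  have hbig : ∀ z ∈ Metric.sphere (0 : ℂ) (N + 1 / 2),
      ‖g z‖ < ‖Complex.sin (Real.pi * z)‖ := by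
    intro z hz
    have hz' : ‖z‖ = N + 1 / 2 := by simpa using hz
    refine hM₁ z (by linarith) fun n => ?_
    have h1 : |‖z‖ - ‖(n : ℂ)‖| ≤ ‖z - n‖ := abs_norm_sub_norm_le _ _
    refine le_trans ?_ h1
    rw [hz', norm_int_complex, ← Int.cast_abs]
    -- The half-integer radius keeps the circle at distance at least `1/2` from every integer.
    rcases le_or_gt |n| (N : ℤ) with h | h
    · have : ((|n| : ℤ) : ℝ) ≤ N := by exact_mod_cast h
      exact le_trans (by linarith) (le_abs_self _)
    · have : (N : ℝ) + 1 ≤ ((|n| : ℤ) : ℝ) := by exact_mod_cast h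
      exact le_trans (by linarith) (neg_le_abs _)
  have habs : ∀ n : ℤ, (N : ℤ) < |n| → (N : ℝ) + 1 ≤ |(n : ℝ)| := by
    intro n hn
    rw [← Int.cast_abs]
    exact_mod_cast hn
  have hsmall : ∀ n : ℤ, (N : ℤ) < |n| → ∀ z ∈ Metric.sphere (n : ℂ) (1 / 4),
      ‖g z‖ < ‖Complex.sin (Real.pi * z)‖ := by
    intro n hn z hz
    have hz' : ‖z - n‖ = 1 / 4 := mem_sphere_iff_norm.1 hz
    have h1 := habs n hn
    rw [← norm_int_complex] at h1
    refine hM₁ z ?_ fun m => ?_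
    · have := norm_sub_norm_le (n : ℂ) z
      rw [norm_sub_rev] at this
      linarith
    · rcases eq_or_ne m n with rfl | hmn
      · exact hz'.ge
      · have h2 := one_le_norm_int_sub hmn
        have h3 := norm_sub_le_norm_sub_add_norm_sub (m : ℂ) z n
        rw [norm_sub_rev (m : ℂ) z] at h3
        linarith
  have hw : ∃ w, f w ≠ 0 := by
    refine ⟨((N + 1 / 2 : ℝ) : ℂ), fun h => ?_⟩
    have h1 := hbig ((N + 1 / 2 : ℝ) : ℂ) (by
      rw [mem_sphere_iff_norm, sub_zero, Complex.norm_real, Real.norm_eq_abs, abs_of_nonneg]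
      positivity)
    rw [hf] at h
    rw [eq_neg_of_add_eq_zero_left h, norm_neg] at h1
    exact lt_irrefl _ h1
  obtain ⟨w, hw⟩ := hw
  have hord : ∀ z, ((analyticOrderNatAt f z : ℕ) : ℕ∞) = analyticOrderAt f z := fun z =>
    Nat.cast_analyticOrderNatAt (analyticOrderAt_ne_top_of_ne_zero hfd hw z)
  -- counting zeros by Rouché's theorem
  have hcount_big : zeroCount f 0 (N + 1 / 2) = (Finset.Icc (-(N : ℤ)) N).card := by
    rw [hfe, zeroCount_add_eq differentiable_sin_pi hg.differentiable (by positivity) hbig,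
      zeroCount_sin_pi]
    intro n
    rw [Metric.mem_ball, dist_zero_right, norm_int_complex, Finset.mem_Icc, ← abs_le,
      ← Int.cast_abs]
    constructor
    · intro h
      have : ((|n| : ℤ) : ℝ) ≤ N := by exact_mod_cast h
      linarith
    · intro h
      by_contra hcon
      have : (N : ℝ) + 1 ≤ ((|n| : ℤ) : ℝ) := by exact_mod_cast not_le.1 hcon
      linarith
  have hcount_small : ∀ n : ℤ, (N : ℤ) < |n| → zeroCount f n (1 / 4) = 1 := by
    intro n hn
    rw [hfe, zeroCount_add_eq differentiable_sin_pi hg.differentiable (by norm_num)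
      (hsmall n hn), zeroCount_sin_pi {n}]
    · simp
    intro m
    rw [Finset.mem_singleton, Metric.mem_ball, dist_eq_norm]
    constructor
    · rintro rfl; simp
    · intro h
      by_contra hmn
      linarith [one_le_norm_int_sub hmn]
  -- Stated as an implication so that `choose` gives a total function; its values for `|n| ≤ N` are
  -- never used.
  have hex : ∀ n : ℤ, ∃ z : ℂ, (N : ℤ) < |n| → z ∈ Metric.ball (n : ℂ) (1 / 4) ∧
      analyticOrderNatAt f z = 1 ∧ ∀ x ∈ Metric.ball (n : ℂ) (1 / 4), f x = 0 → x = z := by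
    intro n
    by_cases hn : (N : ℤ) < |n|
    · obtain ⟨z, hz⟩ := exists_unique_zero_of_zeroCount_eq_one hfd hw (hcount_small n hn)
      exact ⟨z, fun _ => hz⟩
    · exact ⟨0, fun h => absurd h hn⟩
  choose μ hμ using hex
  have hμ_norm : ∀ n : ℤ, (N : ℤ) < |n| → (N : ℝ) + 1 / 2 < ‖μ n‖ := by
    intro n hn
    have h1 := habs n hn
    rw [← norm_int_complex] at h1
    have h2 : ‖μ n - n‖ < 1 / 4 := mem_ball_iff_norm.1 (hμ n hn).1
    have := norm_sub_norm_le (n : ℂ) (μ n)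
    rw [norm_sub_rev] at this
    linarith
  -- enumeration of the zeros in the big disc
  have hfin := finite_ball_inter_support hfd hw 0 ((N : ℝ) + 1 / 2)
  rw [zeroCount, finsum_mem_eq_sum _ hfin] at hcount_big
  obtain ⟨e, heT, hecard⟩ := exists_enumeration _ _ _ hcount_big
  have hT : ∀ z, z ∈ hfin.toFinset ↔ ‖z‖ < N + 1 / 2 ∧ f z = 0 := by
    intro z
    rw [Finite.mem_toFinset, mem_inter_iff, Function.mem_support,
      analyticOrderNatAt_ne_zero_iff hfd hw, Metric.mem_ball, dist_zero_right]
  have hIcc : ∀ n : ℤ, n ∈ Finset.Icc (-(N : ℤ)) N ↔ ¬ (N : ℤ) < |n| := by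
    intro n; rw [Finset.mem_Icc, ← abs_le, not_lt]
  set lam : ℤ → ℂ := fun n => if (N : ℤ) < |n| then μ n else e n with hlam
  refine ⟨analyticOrderAt_ne_top_of_ne_zero hfd hw, lam, fun n => lam n - n, fun z => ?_, fun n => by ring, ?_⟩
  · rw [← hord]
    by_cases hz : f z = 0
    · rcases lt_or_ge ‖z‖ (N + 1 / 2) with hzN | hzN
      · rw [← hecard z ((hT z).2 ⟨hzN, hz⟩), ← encard_coe_eq_coe_finsetCard]
        congr 1
        ext n
        simp only [mem_ofPred_eq, Finset.coe_filter, hIcc, hlam]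
        by_cases hn : (N : ℤ) < |n|
        · simp only [hn, if_true, not_true_eq_false, false_and, iff_false]
          rintro rfl
          linarith [hμ_norm n hn]
        · simp [hn]
      -- A zero outside the large disc is within `1/4` of an integer, as otherwise the sine
      -- dominates; since `‖z‖ ≥ N + 1/2`, that integer has modulus above `N`.
      · obtain ⟨n, hn⟩ : ∃ n : ℤ, ‖z - n‖ < 1 / 4 := by
          by_contra! hcon
          have h1 := hM₁ z (by linarith) hcon
          rw [hf] at hz
          rw [eq_neg_of_add_eq_zero_left hz, norm_neg] at h1
          exact lt_irrefl _ h1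
        have hnN : (N : ℤ) < |n| := by
          by_contra hcon
          have h1 : ((|n| : ℤ) : ℝ) ≤ N := by exact_mod_cast not_lt.1 hcon
          have h2 := norm_sub_norm_le z n
          rw [norm_int_complex, ← Int.cast_abs] at h2
          linarith
        have hzμ : z = μ n := (hμ n hnN).2.2 z (mem_ball_iff_norm.2 hn) hz
        rw [hzμ, (hμ n hnN).2.1]
        -- The discs of radius `1/4` are disjoint, and the indices with `|m| ≤ N` only name zeros
        -- inside the large disc.
        have : {m : ℤ | lam m = μ n} = {n} := by
          ext m
          simp only [mem_ofPred_eq, mem_singleton_iff]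
          constructor
          · intro h
            by_cases hm : (N : ℤ) < |m|
            · simp only [hlam, hm, if_true] at h
              by_contra hmn
              have h1 := one_le_norm_int_sub hmn
              have h2 : ‖μ m - m‖ < 1 / 4 := mem_ball_iff_norm.1 (hμ m hm).1
              rw [h, ← hzμ, norm_sub_rev] at h2
              have h3 := norm_sub_le_norm_sub_add_norm_sub (m : ℂ) z n
              linarith
            · simp only [hlam, hm, if_false] at h
              have h1 := ((hT _).1 (heT m ((hIcc m).2 hm))).1
              rw [h, ← hzμ] at h1
              linarith
          · rintro rfl
            simp [hlam, hnN]
        rw [this]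
        simp
    · have h0 : analyticOrderNatAt f z = 0 := by
        by_contra h
        exact hz ((analyticOrderNatAt_ne_zero_iff hfd hw z).1 h)
      rw [h0, Nat.cast_zero, encard_eq_zero, eq_empty_iff_forall_notMem]
      rintro n rfl
      apply hz
      by_cases hn : (N : ℤ) < |n|
      · simp only [hlam, hn, if_true]
        exact (analyticOrderNatAt_ne_zero_iff hfd hw _).1 (by rw [(hμ n hn).2.1]; exact one_ne_zero)
      · simp only [hlam, hn, if_false]
        exact ((hT _).1 (heT n ((hIcc n).2 hn))).2
  · refine memℓp_gen ?_
    have hsum := hg.summable 0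
    simp only [add_zero] at hsum
    have hfinN : {n : ℤ | ¬ (N : ℤ) < |n|}.Finite := by
      refine (Finset.Icc (-(N : ℤ)) N).finite_toSet.subset fun n hn => ?_
      exact (hIcc n).2 hn
    refine Summable.of_norm_bounded_eventually hsum ?_
    rw [Filter.eventually_cofinite]
    refine hfinN.subset fun n hn hnN => hn ?_
    have hlamn : lam n = μ n := by simp [hlam, hnN]
    have h1 : ‖μ n - n‖ < 1 / 4 := mem_ball_iff_norm.1 (hμ n hnN).1
    have h2 : f (μ n) = 0 :=
      (analyticOrderNatAt_ne_zero_iff hfd hw _).1 (by rw [(hμ n hnN).2.1]; exact one_ne_zero)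
    rw [hf] at h2
    -- At the zero, `2‖κ n‖ ≤ ‖sin (π κ n)‖ = ‖g (μ n)‖ ≤ ‖g n‖ + ‖κ n‖`, so `‖κ n‖ ≤ ‖g n‖`.
    have h3 : 2 * ‖μ n - n‖ ≤ ‖g (μ n)‖ := by
      rw [← norm_neg (g (μ n)), ← eq_neg_of_add_eq_zero_left h2, ← norm_sin_pi_sub_int (μ n) n]
      refine two_mul_norm_le_norm_sin_pi ((Complex.abs_re_le_norm _).trans ?_)
      linarith
    have h4 := hM₂ n (μ n - n) (by linarith [habs n hnN]) (by linarith)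
    rw [add_sub_cancel] at h4
    have h5 : ‖μ n - n‖ ≤ ‖g n‖ := by
      have := norm_sub_norm_le (g (μ n)) (g n)
      linarith
    simp only [hlamn, ENNReal.toReal_ofNat, Real.rpow_ofNat]
    rw [Real.norm_of_nonneg (by positivity)]
    gcongr

/-! ### Constructing sine remainders: closure properties and Fourier integrals. -/

namespace IsSineRemainder

variable {g h : ℂ → ℂ}

theorem add (hg : IsSineRemainder g) (hh : IsSineRemainder h) :
    IsSineRemainder fun z => g z + h z where
  differentiable := hg.differentiable.add hh.differentiable
  norm_le := by
    obtain ⟨C, b, hb, hC⟩ := hg.norm_le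
    obtain ⟨C', b', hb', hC'⟩ := hh.norm_le
    have h0 : 0 ≤ C := by simpa using (norm_nonneg _).trans (hC 0)
    have h0' : 0 ≤ C' := by simpa using (norm_nonneg _).trans (hC' 0)
    refine ⟨C + C', max b b', max_lt hb hb', fun z => ?_⟩
    rw [add_mul]
    refine norm_add_le_of_le ((hC z).trans ?_) ((hC' z).trans ?_)
    · gcongr; exact le_max_left _ _
    · gcongr; exact le_max_right _ _
  summable c := by
    refine Summable.of_nonneg_of_le (fun n => by positivity) (fun n => ?_)
      (((hg.summable c).add (hh.summable c)).mul_left 2)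
    have := norm_add_le (g (n + c)) (h (n + c))
    nlinarith [sq_nonneg (‖g (n + c)‖ - ‖h (n + c)‖), norm_nonneg (g (n + c) + h (n + c))]

theorem const_mul (hg : IsSineRemainder g) (k : ℂ) : IsSineRemainder fun z => k * g z where
  differentiable := hg.differentiable.const_mul k
  norm_le := by
    obtain ⟨C, b, hb, hC⟩ := hg.norm_le
    refine ⟨‖k‖ * C, b, hb, fun z => ?_⟩
    rw [norm_mul, mul_assoc]
    gcongr
    exact hC z
  summable c := by
    simp_rw [norm_mul, mul_pow]
    exact (hg.summable c).mul_left _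

theorem comp_neg (hg : IsSineRemainder g) : IsSineRemainder fun z => g (-z) where
  differentiable := hg.differentiable.comp differentiable_neg
  norm_le := by
    obtain ⟨C, b, hb, hC⟩ := hg.norm_le
    exact ⟨C, b, hb, fun z => by simpa using hC (-z)⟩
  summable c := by
    have := (hg.summable (-c)).comp_injective neg_injective
    refine this.congr fun n => ?_
    simp only [Function.comp_apply]
    congr 3
    push_cast
    ring

theorem comp_add_real (hg : IsSineRemainder g) (σ : ℝ) : IsSineRemainder fun z => g (z + σ) where
  differentiable := hg.differentiable.comp (differentiable_id.add_const _)
  norm_le := by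
    obtain ⟨C, b, hb, hC⟩ := hg.norm_le
    exact ⟨C, b, hb, fun z => by simpa using hC (z + σ)⟩
  summable c := by
    simpa only [add_assoc] using hg.summable (c + σ)

end IsSineRemainder

theorem norm_exp_I_mul (z : ℂ) (x : ℝ) :
    ‖Complex.exp (Complex.I * z * x)‖ = Real.exp (-(z.im * x)) := by
  rw [Complex.norm_exp]
  congr 1
  simp

theorem norm_exp_I_mul_le (z : ℂ) {x b : ℝ} (hx : |x| ≤ b) :
    ‖Complex.exp (Complex.I * z * x)‖ ≤ Real.exp (b * |z.im|) := by
  rw [norm_exp_I_mul, Real.exp_le_exp]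
  calc -(z.im * x) ≤ |z.im * x| := neg_le_abs _
    _ = |x| * |z.im| := by rw [abs_mul, mul_comm]
    _ ≤ b * |z.im| := by gcongr

theorem differentiable_fourierIntegral {w : ℝ → ℂ}
    (hw : Integrable w (volume.restrict (Ioc 0 Real.pi))) (d : ℝ) :
    Differentiable ℂ fun z : ℂ =>
      ∫ t in Ioc 0 Real.pi, w t * Complex.exp (Complex.I * z * (d - 2 * t : ℝ)) := by
  intro z₀
  set D := |d| + 2 * Real.pi with hD
  have hDt : ∀ t ∈ Ioc 0 Real.pi, |d - 2 * t| ≤ D := by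
    intro t ht
    have h1 := abs_sub d (2 * t)
    rw [abs_of_pos (by linarith [ht.1] : 0 < 2 * t)] at h1
    linarith [ht.2]
  have hD0 : 0 ≤ D := by positivity
  have hcont : ∀ z : ℂ, Continuous fun t : ℝ => Complex.exp (Complex.I * z * (d - 2 * t : ℝ)) := by
    intro z; fun_prop
  have hexp : ∀ z ∈ Metric.ball z₀ 1, ∀ t ∈ Ioc 0 Real.pi,
      ‖Complex.exp (Complex.I * z * (d - 2 * t : ℝ))‖ ≤ Real.exp (D * (‖z₀‖ + 1)) := by
    intro z hz t ht
    refine (norm_exp_I_mul_le z (hDt t ht)).trans ?_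
    gcongr
    have h1 := Complex.abs_im_le_norm z
    have h2 := norm_sub_norm_le z z₀
    have h3 : ‖z - z₀‖ < 1 := mem_ball_iff_norm.1 hz
    linarith
  have hint : ∀ z : ℂ, Integrable
      (fun t : ℝ => w t * Complex.exp (Complex.I * z * (d - 2 * t : ℝ)))
      (volume.restrict (Ioc 0 Real.pi)) := by
    intro z
    refine hw.mul_bdd (c := Real.exp (D * |z.im|)) (hcont z).aestronglyMeasurable ?_
    filter_upwards [ae_restrict_mem measurableSet_Ioc] with t ht
    exact norm_exp_I_mul_le z (hDt t ht)
  refine (hasDerivAt_integral_of_dominated_loc_of_deriv_le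
    (F' := fun z t => w t * (Complex.exp (Complex.I * z * (d - 2 * t : ℝ)) *
      (Complex.I * (d - 2 * t : ℝ))))
    (bound := fun t => ‖w t‖ * (Real.exp (D * (‖z₀‖ + 1)) * D))
    (Metric.ball_mem_nhds z₀ one_pos) (Filter.Eventually.of_forall fun z =>
      (hint z).aestronglyMeasurable) (hint z₀) ?_ ?_ (hw.norm.mul_const _) ?_).2.differentiableAt
  · refine hw.aestronglyMeasurable.mul (Continuous.aestronglyMeasurable ?_)
    fun_prop
  · filter_upwards [ae_restrict_mem measurableSet_Ioc] with t ht z hz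
    rw [norm_mul, norm_mul, norm_mul, Complex.norm_I, one_mul, Complex.norm_real, Real.norm_eq_abs]
    gcongr
    · exact hexp z hz t ht
    · exact hDt t ht
  · refine Filter.Eventually.of_forall fun t z _ => ?_
    refine HasDerivAt.const_mul _ (HasDerivAt.cexp ?_)
    have h1 := ((hasDerivAt_id z).const_mul Complex.I).mul_const ((d - 2 * t : ℝ) : ℂ)
    simpa using h1

/-- The support condition bounds the type by `b`. At `n + c` the factor `e^{-2int}` has period `π`,
so up to a unimodular factor the value is `π` times a Fourier coefficient on `(0, π)`, and Parseval
applies. -/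
theorem isSineRemainder_fourierIntegral {w : ℝ → ℂ}
    (hw : MemLp w 2 (volume.restrict (Ioc 0 Real.pi))) {d b : ℝ} (hb : b < Real.pi)
    (hsupp : ∀ t ∈ Ioc 0 Real.pi, w t ≠ 0 → |d - 2 * t| ≤ b) :
    IsSineRemainder fun z : ℂ =>
      ∫ t in Ioc 0 Real.pi, w t * Complex.exp (Complex.I * z * (d - 2 * t : ℝ)) := by
  have hw1 : Integrable w (volume.restrict (Ioc 0 Real.pi)) := hw.integrable (by norm_num)
  have hle : ∀ z : ℂ, ∀ t ∈ Ioc 0 Real.pi,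
      ‖w t * Complex.exp (Complex.I * z * (d - 2 * t : ℝ))‖ ≤ ‖w t‖ * Real.exp (b * |z.im|) := by
    intro z t ht
    rw [norm_mul]
    by_cases h0 : w t = 0
    · simp [h0]
    · gcongr
      exact norm_exp_I_mul_le z (hsupp t ht h0)
  refine ⟨differentiable_fourierIntegral hw1 d,
    ⟨∫ t in Ioc 0 Real.pi, ‖w t‖, b, hb, fun z => ?_⟩, fun c => ?_⟩
  · rw [← integral_mul_const]
    refine norm_integral_le_of_norm_le (hw1.norm.mul_const _) ?_
    filter_upwards [ae_restrict_mem measurableSet_Ioc] with t ht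
    exact hle z t ht
  · set f : ℝ → ℂ := fun t => w t * Complex.exp (Complex.I * c * (d - 2 * t : ℝ)) with hf
    have hfL : MemLp f 2 (volume.restrict (Ioc 0 Real.pi)) := by
      refine hw.of_le_mul (c := Real.exp (b * |c.im|)) ?_ ?_
      · refine hw.aestronglyMeasurable.mul (Continuous.aestronglyMeasurable ?_)
        fun_prop
      · filter_upwards [ae_restrict_mem measurableSet_Ioc] with t ht
        rw [mul_comm]
        exact hle c t ht
    have hs := (hasSum_sq_fourierCoeffOn Real.pi_pos hfL).summable.mul_left (Real.pi ^ 2)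
    refine hs.congr fun n => ?_
    rw [← mul_pow]
    congr 1
    rw [fourierCoeffOn_eq_integral, intervalIntegral.integral_of_le Real.pi_pos.le]
    have h1 : ∀ t : ℝ, w t * Complex.exp (Complex.I * (n + c) * (d - 2 * t : ℝ))
        = Complex.exp (Complex.I * n * d) *
          (fourier (-n) (t : AddCircle (Real.pi - 0)) • f t) := by
      intro t
      rw [fourier_coe_apply, hf, smul_eq_mul]
      dsimp only
      rw [mul_left_comm (Complex.exp (2 * _ * _ * _ * _ / _)), mul_left_comm, ← Complex.exp_add,
        ← Complex.exp_add]
      congr 2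
      have : (Real.pi : ℂ) ≠ 0 := by exact_mod_cast Real.pi_ne_zero
      push_cast
      rw [sub_zero]
      field_simp
      ring
    simp_rw [h1]
    rw [integral_const_mul, norm_mul, norm_smul]
    have h2 : ‖Complex.exp (Complex.I * n * d)‖ = 1 := by
      rw [norm_exp_I_mul]; simp
    rw [h2, sub_zero, Real.norm_of_nonneg (by positivity)]
    have := Real.pi_ne_zero
    field_simp

/-- The cross-correlation of two square-integrable functions is bounded. -/
theorem norm_integral_mul_sub_le {r s : ℝ → ℂ} (hr : MemLp r 2 volume) (hs : MemLp s 2 volume)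
    (ω : ℝ) : ‖∫ t, r t * s (t - ω)‖ ≤ (∫ t, ‖r t‖ ^ 2) + ∫ t, ‖s t‖ ^ 2 := by
  have hr2 : Integrable (fun t => ‖r t‖ ^ 2) := hr.integrable_norm_pow (by norm_num)
  have hs2 : Integrable (fun t => ‖s t‖ ^ 2) := hs.integrable_norm_pow (by norm_num)
  have hs3 : Integrable (fun t => ‖s (t - ω)‖ ^ 2) := hs2.comp_sub_right ω
  rw [← integral_sub_right_eq_self (fun t => ‖s t‖ ^ 2) ω, ← integral_add hr2 hs3]
  refine norm_integral_le_of_norm_le (hr2.add hs3) (Filter.Eventually.of_forall fun t => ?_)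
  rw [norm_mul]
  nlinarith [sq_nonneg (‖r t‖ - ‖s (t - ω)‖), sq_nonneg ‖r t‖, sq_nonneg ‖s (t - ω)‖]

/-- This is the convolution integrand of `r` with `t ↦ s (-t)`. -/
theorem integrable_mul_comp_sub {r s : ℝ → ℂ} (hr : Integrable r) (hs : Integrable s) :
    Integrable (fun p : ℝ × ℝ => r p.2 * s (p.2 - p.1)) (volume.prod volume) := by
  have := hr.convolution_integrand (ContinuousLinearMap.mul ℝ ℂ) hs.comp_neg
  simpa using this

/-- A double Fourier-type integral over the triangle `a ≤ t - τ` is a sine remainder. -/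
theorem isSineRemainder_iterated {r s : ℝ → ℂ} {a : ℝ} (ha : 0 < a)
    (haπ : a < Real.pi) (hr : MemLp r 2 volume) (hs : MemLp s 2 volume) (hri : Integrable r) (hsi : Integrable s)
    (hr0 : ∀ t ∉ Ioc a Real.pi, r t = 0) (hs0 : ∀ t ∉ Ioc a Real.pi, s t = 0) :
    IsSineRemainder fun z : ℂ => ∫ t in Ioc 0 Real.pi,
      r t * Complex.exp (Complex.I * z * (Real.pi - 2 * t : ℝ)) *
        ∫ τ in Ioc 0 (t - a), s τ * Complex.exp (Complex.I * z * (2 * τ : ℝ)) := by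
  -- Substitute `ω = t - τ`: the exponent `π - 2t + 2τ` becomes `π - 2ω`, and `a < τ ≤ t - a`, `t ≤
  -- π` force `ω` into `[a, π - a]`. By Fubini the double integral is the Fourier integral of the
  -- truncated cross-correlation `w`, which is bounded.
  set w : ℝ → ℂ := (Icc a (Real.pi - a)).indicator fun ω => ∫ t, r t * s (t - ω) with hw
  have hint := integrable_mul_comp_sub hri hsi
  have hwL : MemLp w 2 (volume.restrict (Ioc 0 Real.pi)) := by
    refine MemLp.of_bound ?_ ((∫ t, ‖r t‖ ^ 2) + ∫ t, ‖s t‖ ^ 2) ?_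
    · exact (hint.integral_prod_left.aestronglyMeasurable.indicator measurableSet_Icc).restrict
    · refine Filter.Eventually.of_forall fun ω => ?_
      rw [hw]
      refine (norm_indicator_le_norm_self _ _).trans ?_
      exact norm_integral_mul_sub_le hr hs ω
  have hrem := isSineRemainder_fourierIntegral (b := |Real.pi - 2 * a|) hwL (d := Real.pi) ?_ ?_
  · convert hrem using 2 with z
    -- the kernel in the variables `(ω, t)`
    set k : ℝ → ℂ := (Icc a (Real.pi - a)).indicator
      fun ω => Complex.exp (Complex.I * z * (Real.pi - 2 * ω : ℝ)) with hk
    have hkm : Measurable k := by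
      refine Measurable.indicator (Continuous.measurable ?_) measurableSet_Icc
      fun_prop
    obtain ⟨C, hC⟩ : ∃ C, ∀ ω, ‖k ω‖ ≤ C := by
      refine ⟨Real.exp (|Real.pi - 2 * a| * |z.im|), fun ω => ?_⟩
      rw [hk]
      by_cases hω : ω ∈ Icc a (Real.pi - a)
      · rw [indicator_of_mem hω]
        refine norm_exp_I_mul_le z ?_
        rw [abs_of_nonneg (by linarith [hω.1, hω.2] : 0 ≤ Real.pi - 2 * a), abs_le]
        exact ⟨by linarith [hω.2], by linarith [hω.1]⟩
      · rw [indicator_of_notMem hω, norm_zero]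
        positivity
    have hint2 : Integrable (fun p : ℝ × ℝ => r p.2 * s (p.2 - p.1) * k p.1)
        (volume.prod volume) :=
      hint.mul_bdd (c := C) (hkm.comp measurable_fst).aestronglyMeasurable
        (Filter.Eventually.of_forall fun p => hC p.1)
    have hswap := integral_integral_swap (f := fun ω t => r t * s (t - ω) * k ω) hint2
    have hright : ∫ ω in Ioc 0 Real.pi,
        w ω * Complex.exp (Complex.I * z * (Real.pi - 2 * ω : ℝ))
        = ∫ ω, ∫ t, r t * s (t - ω) * k ω := by
      rw [← integral_indicator measurableSet_Ioc]
      congr 1 with ω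
      rw [integral_mul_const, hw, hk]
      by_cases hω : ω ∈ Icc a (Real.pi - a)
      · rw [indicator_of_mem hω, indicator_of_mem, indicator_of_mem hω]
        exact ⟨by linarith [hω.1], by linarith [hω.2]⟩
      · rw [indicator_of_notMem hω (fun ω => Complex.exp _), mul_zero]
        by_cases h2 : ω ∈ Ioc 0 Real.pi
        · rw [indicator_of_mem h2, indicator_of_notMem hω, zero_mul]
        · rw [indicator_of_notMem h2]
    rw [hright, hswap, ← integral_indicator measurableSet_Ioc]
    congr 1 with t
    by_cases ht : t ∈ Ioc a Real.pi
    · rw [indicator_of_mem (show t ∈ Ioc 0 Real.pi from ⟨by linarith [ht.1], ht.2⟩),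
        ← integral_sub_left_eq_self _ volume t, ← integral_indicator measurableSet_Ioc,
        ← integral_const_mul]
      congr 1 with τ
      rw [sub_sub_cancel]
      by_cases hτ : τ ∈ Ioc a Real.pi
      · by_cases hτ2 : τ ≤ t - a
        · rw [indicator_of_mem (show τ ∈ Ioc 0 (t - a) from ⟨by linarith [hτ.1], hτ2⟩), hk,
            indicator_of_mem (show t - τ ∈ Icc a (Real.pi - a) from
              ⟨by linarith, by linarith [ht.2, hτ.1]⟩)]
          rw [mul_mul_mul_comm, ← Complex.exp_add]
          congr 2
          push_cast
          ring
        · rw [indicator_of_notMem (fun h => hτ2 h.2), hk,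
            indicator_of_notMem (fun h => hτ2 (by linarith [h.1]))]
          simp
      · have h1 : (Ioc 0 (t - a)).indicator
            (fun τ => s τ * Complex.exp (Complex.I * z * (2 * τ : ℝ))) τ = 0 := by
          rw [indicator_apply_eq_zero]
          intro _
          rw [hs0 τ hτ, zero_mul]
        rw [h1, hs0 τ hτ]
        simp
    · have h1 : (Ioc 0 Real.pi).indicator (fun t =>
          r t * Complex.exp (Complex.I * z * (Real.pi - 2 * t : ℝ)) *
          ∫ τ in Ioc 0 (t - a), s τ * Complex.exp (Complex.I * z * (2 * τ : ℝ))) t = 0 := by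
        rw [indicator_apply_eq_zero]
        intro _
        rw [hr0 t ht]; simp
      rw [h1]
      simp [hr0 t ht]
  · rw [abs_lt]
    exact ⟨by linarith, by linarith⟩
  · intro ω _ hω
    have hω2 : ω ∈ Icc a (Real.pi - a) := mem_of_indicator_ne_zero hω
    rw [abs_of_nonneg (by linarith [hω2.1, hω2.2] : 0 ≤ Real.pi - 2 * a), abs_le]
    exact ⟨by linarith [hω2.2], by linarith [hω2.1]⟩

/-! ### Absolutely continuous functions with complex or vector values. -/

section AbsolutelyContinuous

variable {α β : ℝ}

theorem absolutelyContinuousOnInterval_of_dist_le {X Y : Type*} [PseudoMetricSpace X]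
    [PseudoMetricSpace Y] {F : ℝ → X} {G : ℝ → Y} (hG : AbsolutelyContinuousOnInterval G α β)
    (h : ∀ x y, dist (F x) (F y) ≤ dist (G x) (G y)) : AbsolutelyContinuousOnInterval F α β := by
  rw [absolutelyContinuousOnInterval_iff] at hG ⊢
  intro ε hε
  obtain ⟨δ, hδ, hE⟩ := hG ε hε
  exact ⟨δ, hδ, fun E hEd hlt =>
    (Finset.sum_le_sum fun k _ => h _ _).trans_lt (hE E hEd hlt)⟩

theorem absolutelyContinuousOnInterval_of_contDiff {E : Type*} [NormedAddCommGroup E]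
    [NormedSpace ℝ E] {f : ℝ → E} (hf : ContDiff ℝ 1 f) (α β : ℝ) :
    AbsolutelyContinuousOnInterval f α β :=
  hf.contDiffOn.absolutelyContinuousOnInterval

theorem absolutelyContinuousOnInterval_primitive {f : ℝ → ℂ}
    (hf : ∀ x y : ℝ, IntervalIntegrable f volume x y) (α β : ℝ) :
    AbsolutelyContinuousOnInterval (fun x => ∫ t in α..x, f t) α β := by
  -- Increments are dominated by those of the real primitive of `‖f‖`.
  refine absolutelyContinuousOnInterval_of_dist_le
    ((hf α β).norm.absolutelyContinuousOnInterval_intervalIntegral left_mem_uIcc) fun x y => ?_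
  rw [dist_eq_norm, Real.dist_eq, intervalIntegral.integral_interval_sub_left (hf α x) (hf α y),
    intervalIntegral.integral_interval_sub_left (hf α x).norm (hf α y).norm]
  exact intervalIntegral.norm_integral_le_abs_integral_norm

theorem absolutelyContinuousOnInterval_apply {ι : Type*} [Fintype ι] {y : ℝ → ι → ℂ}
    (hy : AbsolutelyContinuousOnInterval y α β) (i : ι) :
    AbsolutelyContinuousOnInterval (fun x => y x i) α β :=
  absolutelyContinuousOnInterval_of_dist_le hy fun _ _ => dist_le_pi_dist _ _ i

theorem absolutelyContinuousOnInterval_fin_two {y : ℝ → Fin 2 → ℂ}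
    (h₀ : AbsolutelyContinuousOnInterval (fun x => y x 0) α β)
    (h₁ : AbsolutelyContinuousOnInterval (fun x => y x 1) α β) :
    AbsolutelyContinuousOnInterval y α β := by
  have h := (h₀.fun_smul (absolutelyContinuousOnInterval_of_contDiff
    (contDiff_const (c := (![1, 0] : Fin 2 → ℂ))) α β)).fun_add
    (h₁.fun_smul (absolutelyContinuousOnInterval_of_contDiff
    (contDiff_const (c := (![0, 1] : Fin 2 → ℂ))) α β))
  have hy : y = fun x => y x 0 • (![1, 0] : Fin 2 → ℂ) + y x 1 • ![0, 1] := by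
    funext x i
    fin_cases i <;> simp
  rw [hy]
  exact h

end AbsolutelyContinuous

/-! ### Explicit solution of the diagonalised delay system. -/

theorem contDiff_exp_I_mul (z : ℂ) :
    ContDiff ℝ 1 fun x : ℝ => Complex.exp (Complex.I * z * x) :=
  (contDiff_const.mul Complex.ofRealCLM.contDiff).cexp

/-- The solution operator of `u' = i z u + r(x) f(x - a)`, `u(0) = 0`. -/
def delayOp (a : ℝ) (z : ℂ) (r f : ℝ → ℂ) (x : ℝ) : ℂ :=
  Complex.exp (Complex.I * z * x) *
    ∫ t in (0 : ℝ)..x, Complex.exp (-(Complex.I * z * t)) * (r t * f (t - a))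

section delayOp

variable {a : ℝ} {z : ℂ} {r f : ℝ → ℂ}

theorem intervalIntegrable_delayOp (z : ℂ) (hr : Integrable r) (hf : Continuous f) (x y : ℝ) :
    IntervalIntegrable (fun t : ℝ => Complex.exp (-(Complex.I * z * t)) * (r t * f (t - a)))
      volume x y := by
  refine IntervalIntegrable.continuousOn_mul ?_ (Continuous.continuousOn (by fun_prop))
  exact hr.intervalIntegrable.mul_continuousOn (Continuous.continuousOn (by fun_prop))

theorem continuous_delayOp (hr : Integrable r) (hf : Continuous f) :
    Continuous (delayOp a z r f) := by
  exact (contDiff_exp_I_mul z).continuous.mul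
    (intervalIntegral.continuous_primitive (intervalIntegrable_delayOp z hr hf) 0)

theorem absolutelyContinuousOnInterval_delayOp (hr : Integrable r) (hf : Continuous f) (β : ℝ) :
    AbsolutelyContinuousOnInterval (delayOp a z r f) 0 β := by
  have h₁ := absolutelyContinuousOnInterval_of_contDiff (contDiff_exp_I_mul z) 0 β
  have h₂ := absolutelyContinuousOnInterval_primitive
    (intervalIntegrable_delayOp (a := a) z hr hf) 0 β
  have h := h₁.fun_smul h₂
  simp only [smul_eq_mul] at h
  exact h

theorem hasDerivAt_exp_I_mul (z : ℂ) (x : ℝ) :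
    HasDerivAt (fun x : ℝ => Complex.exp (Complex.I * z * x))
      (Complex.I * z * Complex.exp (Complex.I * z * x)) x := by
  have h := ((hasDerivAt_id (x : ℂ)).const_mul (Complex.I * z)).cexp.comp_ofReal
  simp only [id, mul_one] at h
  rw [mul_comm (Complex.I * z) (Complex.exp _)]
  exact h

theorem ae_hasDerivAt_delayOp (a : ℝ) (z : ℂ) (hr : Integrable r) (hf : Continuous f) :
    ∀ᵐ x : ℝ, HasDerivAt (delayOp a z r f)
      (Complex.I * z * delayOp a z r f x + r x * f (x - a)) x := by
  have hloc : LocallyIntegrable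
      (fun t : ℝ => Complex.exp (-(Complex.I * z * t)) * (r t * f (t - a))) volume := by
    rw [locallyIntegrable_iff]
    intro K hK
    obtain ⟨R, hR⟩ := hK.isBounded.subset_closedBall 0
    rw [Real.closedBall_eq_Icc] at hR
    refine IntegrableOn.mono_set ?_ hR
    rcases le_or_gt (0 - R) (0 + R) with h | h
    · exact (intervalIntegrable_iff_integrableOn_Icc_of_le h).1
        (intervalIntegrable_delayOp z hr hf _ _)
    · rw [Icc_eq_empty h.not_ge]; exact integrableOn_empty
  filter_upwards [LocallyIntegrable.ae_hasDerivAt_integral hloc] with x hx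
  refine ((hasDerivAt_exp_I_mul z x).mul (hx 0)).congr_deriv ?_
  rw [delayOp, ← mul_assoc (Complex.exp (Complex.I * z * x)), ← Complex.exp_add, add_neg_cancel,
    Complex.exp_zero, one_mul, mul_assoc]

theorem delayOp_eq_zero_of_le (hr0 : ∀ t ≤ a, r t = 0) (ha : 0 < a) {x : ℝ} (hx : x ≤ a) :
    delayOp a z r f x = 0 := by
  rw [delayOp, intervalIntegral.integral_zero_ae, mul_zero]
  refine Filter.Eventually.of_forall fun t ht => ?_
  -- The interval of integration is unordered because `x` may be negative.
  have htm : t ≤ max 0 x := ht.2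
  rw [hr0 t (htm.trans (max_le ha.le hx))]
  simp

/-- Each application pushes the start of the support to the right by `a`; this terminates the
iteration. -/
theorem delayOp_eq_zero_of_le_add (hr0 : ∀ t ≤ a, r t = 0) (ha : 0 < a) {c : ℝ}
    (hf0 : ∀ t ≤ c, f t = 0) {x : ℝ} (hx : x ≤ c + a) : delayOp a z r f x = 0 := by
  rw [delayOp, intervalIntegral.integral_zero_ae, mul_zero]
  refine Filter.Eventually.of_forall fun t ht => ?_
  have htm : t ≤ max 0 x := ht.2
  rcases le_or_gt t a with h | h
  · rw [hr0 t h]; simp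
  · have : t ≤ x := by
      rcases le_max_iff.1 htm with h' | h'
      · linarith
      · exact h'
    rw [hf0 (t - a) (by linarith)]; simp

end delayOp

/-- The free exponential `c e^{i z x}`. -/
def freeExp (z c : ℂ) (x : ℝ) : ℂ := Complex.exp (Complex.I * z * x) * c

theorem continuous_freeExp (z c : ℂ) : Continuous (freeExp z c) := by
  unfold freeExp; fun_prop

/-- The solution `u` of the diagonalised system `u' = i z u + r(x) v(x - a)`,
`v' = -i z v + s(x) u(x - a)` with `u(0) = c`, `v(0) = d`; then `v = diagSol a (-z) s r d c`. -/
def diagSol (a : ℝ) (z : ℂ) (r s : ℝ → ℂ) (c d : ℂ) (x : ℝ) : ℂ :=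
  freeExp z c x + delayOp a z r (freeExp (-z) d) x +
    delayOp a z r (delayOp a (-z) s (freeExp z c)) x

section diagSol

variable {a : ℝ} {z : ℂ} {r s : ℝ → ℂ} {c d : ℂ}

theorem absolutelyContinuousOnInterval_diagSol (hr : Integrable r) (hs : Integrable s) :
    AbsolutelyContinuousOnInterval (diagSol a z r s c d) 0 Real.pi := by
  refine ((absolutelyContinuousOnInterval_of_contDiff ?_ 0 Real.pi).fun_add
    (absolutelyContinuousOnInterval_delayOp hr (continuous_freeExp _ _) _)).fun_add
    (absolutelyContinuousOnInterval_delayOp hr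
      (continuous_delayOp hs (continuous_freeExp _ _)) _)
  exact (contDiff_exp_I_mul z).mul contDiff_const

theorem diagSol_zero : diagSol a z r s c d 0 = c := by
  simp [diagSol, freeExp, delayOp]

theorem ae_hasDerivAt_diagSol (ha : 0 < a) (ha3 : Real.pi < 3 * a) (hr : Integrable r)
    (hs : Integrable s) (hr0 : ∀ t ≤ a, r t = 0) (hs0 : ∀ t ≤ a, s t = 0) :
    ∀ᵐ x : ℝ, x ≤ Real.pi → HasDerivAt (diagSol a z r s c d)
      (Complex.I * z * diagSol a z r s c d x + r x * diagSol a (-z) s r d c (x - a)) x := by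
  filter_upwards [ae_hasDerivAt_delayOp a z hr (continuous_freeExp (-z) d),
    ae_hasDerivAt_delayOp a z hr (continuous_delayOp (a := a) (z := -z) hs (continuous_freeExp z c))]
    with x h1 h2 hx
  have h0 : HasDerivAt (freeExp z c) (Complex.I * z * freeExp z c x) x := by
    have := (hasDerivAt_exp_I_mul z x).mul_const c
    rwa [mul_assoc] at this
  -- The last term of `v` starts only at `2a`, while `x - a ≤ π - a < 2a`; without it,
  -- differentiating `u` reproduces exactly `r(x) v(x - a)`.
  have h3 : delayOp a (-z) s (delayOp a (- -z) r (freeExp (-z) d)) (x - a) = 0 :=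
    delayOp_eq_zero_of_le_add hs0 ha (fun t ht => delayOp_eq_zero_of_le hr0 ha ht)
      (by linarith : x - a ≤ a + a)
  refine ((h0.add h1).add h2).congr_deriv ?_
  rw [diagSol, diagSol, h3]
  simp only [neg_neg]
  ring

end diagSol

/-! ### Potentials, solutions of the Dirac system, and uniqueness. -/

/-- The truncation to `(a, π]` of the combination `p + σ q` of the potentials. -/
def diagPot (a : ℝ) (q p : ℝ → ℂ) (σ : ℂ) : ℝ → ℂ :=
  (Ioc a Real.pi).indicator fun x => p x + σ * q x

section diagPot

variable {a : ℝ} {q p : ℝ → ℂ}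

theorem memLp_diagPot_restrict (ha : 0 < a) (hq : IsPotential a q) (hp : IsPotential a p) (σ : ℂ) :
    MemLp (fun x => p x + σ * q x) 2 (volume.restrict (Ioc a Real.pi)) := by
  have h : MemLp (fun x => p x + σ * q x) 2 (volume.restrict (Ioo 0 Real.pi)) :=
    hp.1.add (hq.1.const_mul σ)
  rw [Measure.restrict_congr_set Ioo_ae_eq_Ioc] at h
  exact h.mono_measure (Measure.restrict_mono (Ioc_subset_Ioc_left ha.le) le_rfl)

theorem memLp_diagPot (ha : 0 < a) (hq : IsPotential a q) (hp : IsPotential a p) (σ : ℂ) :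
    MemLp (diagPot a q p σ) 2 volume :=
  (memLp_indicator_iff_restrict measurableSet_Ioc).2 (memLp_diagPot_restrict ha hq hp σ)

theorem integrable_diagPot (ha : 0 < a) (hq : IsPotential a q) (hp : IsPotential a p) (σ : ℂ) :
    Integrable (diagPot a q p σ) :=
  (integrable_indicator_iff measurableSet_Ioc).2
    ((memLp_diagPot_restrict ha hq hp σ).integrable (by norm_num))

theorem diagPot_of_notMem {σ : ℂ} {t : ℝ} (ht : t ∉ Ioc a Real.pi) : diagPot a q p σ t = 0 :=
  indicator_of_notMem ht _

theorem diagPot_of_le {σ : ℂ} {t : ℝ} (ht : t ≤ a) : diagPot a q p σ t = 0 :=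
  diagPot_of_notMem fun h => absurd h.1 ht.not_gt

theorem ae_eq_zero_of_isPotential {f : ℝ → ℂ} (hf : IsPotential a f) :
    ∀ᵐ x, x ∈ Icc 0 a → f x = 0 := by
  have h := hf.2
  rwa [Measure.restrict_congr_set Ioo_ae_eq_Icc, ae_restrict_iff' measurableSet_Icc] at h

theorem ae_eq_diagPot (hq : IsPotential a q) (hp : IsPotential a p) (σ : ℂ) :
    ∀ᵐ x, x ∈ Ioo 0 Real.pi → diagPot a q p σ x = p x + σ * q x := by
  filter_upwards [ae_eq_zero_of_isPotential hq, ae_eq_zero_of_isPotential hp] with x hqx hpx hx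
  rcases le_or_gt x a with h | h
  · rw [diagPot_of_le h, hqx ⟨hx.1.le, h⟩, hpx ⟨hx.1.le, h⟩]; simp
  · exact indicator_of_mem (show x ∈ Ioc a Real.pi from ⟨h, hx.2.le⟩) _

end diagPot

/-- The vector solution with `y₁(0) + i y₂(0) = c` and `y₁(0) - i y₂(0) = d`. -/
def vecSol (a : ℝ) (q p : ℝ → ℂ) (z c d : ℂ) (x : ℝ) : Fin 2 → ℂ :=
  ![(diagSol a z (diagPot a q p (-Complex.I)) (diagPot a q p Complex.I) c d x +
      diagSol a (-z) (diagPot a q p Complex.I) (diagPot a q p (-Complex.I)) d c x) / 2,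
    (diagSol a z (diagPot a q p (-Complex.I)) (diagPot a q p Complex.I) c d x -
      diagSol a (-z) (diagPot a q p Complex.I) (diagPot a q p (-Complex.I)) d c x) /
        (2 * Complex.I)]

section

variable {a : ℝ} {q p : ℝ → ℂ} {z : ℂ}

theorem isSolution_vecSol (ha : 0 < a) (ha3 : Real.pi < 3 * a) (hq : IsPotential a q)
    (hp : IsPotential a p) (c d : ℂ) : IsSolution a q p z (vecSol a q p z c d) := by
  set r := diagPot a q p (-Complex.I) with hr
  set s := diagPot a q p Complex.I with hs
  have hri := integrable_diagPot ha hq hp (-Complex.I)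
  have hsi := integrable_diagPot ha hq hp Complex.I
  have hr0 : ∀ t ≤ a, r t = 0 := fun t ht => diagPot_of_le ht
  have hs0 : ∀ t ≤ a, s t = 0 := fun t ht => diagPot_of_le ht
  constructor
  · have h₁ := absolutelyContinuousOnInterval_diagSol (a := a) (z := z) (c := c) (d := d) hri hsi
    have h₂ := absolutelyContinuousOnInterval_diagSol (a := a) (z := -z) (c := d) (d := c) hsi hri
    refine absolutelyContinuousOnInterval_fin_two ?_ ?_
    · have h := (h₁.fun_add h₂).const_smul (2⁻¹ : ℂ)
      simp only [smul_eq_mul] at h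
      simp only [vecSol, Matrix.cons_val_zero, div_eq_inv_mul]
      exact h
    · have h := (h₁.fun_sub h₂).const_smul ((2 * Complex.I)⁻¹ : ℂ)
      simp only [smul_eq_mul] at h
      simp only [vecSol, Matrix.cons_val_one, Matrix.cons_val_fin_one, div_eq_inv_mul]
      exact h
  · rw [ae_restrict_iff' measurableSet_Ioo]
    filter_upwards [ae_hasDerivAt_diagSol (z := z) (c := c) (d := d) ha ha3 hri hsi hr0 hs0,
      ae_hasDerivAt_diagSol (z := -z) (c := d) (d := c) ha ha3 hsi hri hs0 hr0,
      ae_eq_diagPot hq hp (-Complex.I), ae_eq_diagPot hq hp Complex.I] with x h1 h2 h3 h4 hx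
    have h1 := h1 hx.2.le
    have h2 := h2 hx.2.le
    rw [h3 hx] at h1
    rw [h4 hx, neg_neg] at h2
    set u := diagSol a z r s c d with hu
    set v := diagSol a (-z) s r d c with hv
    refine ⟨![(Complex.I * z * u x + (p x + -Complex.I * q x) * v (x - a) +
          (Complex.I * -z * v x + (p x + Complex.I * q x) * u (x - a))) / 2,
        (Complex.I * z * u x + (p x + -Complex.I * q x) * v (x - a) -
          (Complex.I * -z * v x + (p x + Complex.I * q x) * u (x - a))) / (2 * Complex.I)],
      hasDerivAt_pi.2 fun i => ?_, ?_⟩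
    · fin_cases i
      · exact (h1.add h2).div_const 2
      · exact (h1.sub h2).div_const (2 * Complex.I)
    · have hI : Complex.I ^ 2 = -1 := Complex.I_sq
      have hI0 := Complex.I_ne_zero
      ext i
      fin_cases i
      · simp [B, Q, vecSol, ← hr, ← hs, ← hu, ← hv]
        field_simp
        ring_nf
      · simp [B, Q, vecSol, ← hr, ← hs, ← hu, ← hv]
        field_simp
        ring_nf
        simp only [hI]
        ring

theorem IsSolution.sub {y w : ℝ → Fin 2 → ℂ} (hy : IsSolution a q p z y)
    (hw : IsSolution a q p z w) : IsSolution a q p z fun x => y x - w x := by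
  refine ⟨hy.1.fun_sub hw.1, ?_⟩
  filter_upwards [hy.2, hw.2] with x ⟨y', hy', hye⟩ ⟨w', hw', hwe⟩
  refine ⟨y' - w', hy'.sub hw', ?_⟩
  rw [Matrix.mulVec_sub, Matrix.mulVec_sub, smul_sub, ← hye, ← hwe]
  abel

theorem IsSolution.const_smul {y : ℝ → Fin 2 → ℂ} (hy : IsSolution a q p z y) (c : ℂ) :
    IsSolution a q p z fun x => c • y x := by
  refine ⟨hy.1.const_smul c, ?_⟩
  filter_upwards [hy.2] with x ⟨y', hy', hye⟩
  refine ⟨c • y', hy'.const_smul c, ?_⟩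
  rw [Matrix.mulVec_smul, Matrix.mulVec_smul, smul_comm z c, ← hye, smul_add]

/-- If the delayed term vanishes on `[0, d]`, a solution with `y(0) = 0` satisfies
`y₁ + σ y₂ = 0` on `[0, d]` for `σ = ± i`. -/
theorem IsSolution.add_mul_eq_zero {y : ℝ → Fin 2 → ℂ} (hy : IsSolution a q p z y)
    (h0 : y 0 = 0) {d : ℝ} (hd0 : 0 ≤ d) (hd : d ≤ Real.pi)
    (hQ : ∀ᵐ x, x ∈ Ioo 0 d → (Q q p x).mulVec (y (x - a)) = 0) {σ : ℂ} (hσ : σ ^ 2 = -1) :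
    ∀ x ∈ Icc 0 d, y x 0 + σ * y x 1 = 0 := by
  have hac := hy.1.mono (c := 0) (d := d) (by
    rw [uIcc_of_le hd0, uIcc_of_le Real.pi_pos.le]; exact Icc_subset_Icc_right hd)
  -- With the delayed term gone, `w = y₁ + σ y₂` satisfies `w' = σ z w`. As `I * k = σ`, the
  -- integrating factor `e^{-σzx}` takes the form `exp (I * ζ * x)` with `ζ = -(k * z)`.
  set k := -(Complex.I)* σ with hk
  have hIk : Complex.I * k = σ := by
    rw [hk, ← mul_assoc, mul_neg, Complex.I_mul_I]; ring
  have h₁ := absolutelyContinuousOnInterval_of_contDiff (contDiff_exp_I_mul (-(k * z))) 0 d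
  have h₂ := (absolutelyContinuousOnInterval_apply hac 0).fun_add
    ((absolutelyContinuousOnInterval_apply hac 1).const_smul σ)
  have h := h₁.fun_smul h₂
  simp only [smul_eq_mul] at h
  have hder : ∀ᵐ x, x ∈ uIcc 0 d → HasDerivAt
      (fun x : ℝ => Complex.exp (Complex.I * -(k * z) * x) * (y x 0 + σ * y x 1)) 0 x := by
    have h2 := hy.2
    rw [ae_restrict_iff' measurableSet_Ioo] at h2
    have hae : ∀ᵐ x : ℝ, x ∈ Ioo 0 d → HasDerivAt
        (fun x : ℝ => Complex.exp (Complex.I * -(k * z) * x) * (y x 0 + σ * y x 1)) 0 x := by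
      filter_upwards [h2, hQ] with x hx hQx hxd
      obtain ⟨y', hy', heq⟩ := hx ⟨hxd.1, hxd.2.trans_le hd⟩
      rw [hQx hxd, add_zero] at heq
      have e0 := congrFun heq 0
      have e1 := congrFun heq 1
      simp [B, Matrix.mulVec, dotProduct, Fin.sum_univ_two] at e0 e1
      have hy'' := hasDerivAt_pi.1 hy'
      refine ((hasDerivAt_exp_I_mul (-(k * z)) x).mul
        ((hy'' 0).add ((hy'' 1).const_mul σ))).congr_deriv ?_
      have e1' : y' 0 = -(z * y x 1) := by rw [← e1]; ring
      simp only [Pi.add_apply]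
      rw [e0, e1']
      linear_combination (-(z * Complex.exp (Complex.I * -(k * z) * x) * (y x 0 + σ * y x 1))) * hIk
        - (z * Complex.exp (Complex.I * -(k * z) * x) * y x 1) * hσ
    rw [uIcc_of_le hd0, ← ae_restrict_iff' measurableSet_Icc, ← Measure.restrict_congr_set Ioo_ae_eq_Icc,
      ae_restrict_iff' measurableSet_Ioo]
    exact hae
  -- Absolute continuity is essential here: a zero derivative almost everywhere would not otherwise
  -- give a constant.
  obtain ⟨C, hC⟩ := h.const_of_ae_hasDerivAt_zero hder
  rw [uIcc_of_le hd0] at hC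
  have hC0 := hC 0 ⟨le_rfl, hd0⟩
  rw [h0] at hC0
  simp only [Pi.zero_apply, mul_zero, add_zero] at hC0
  intro x hx
  have hx' := hC x hx
  rw [← hC0] at hx'
  exact (mul_eq_zero.1 hx').resolve_left (Complex.exp_ne_zero _)

/-- Method of steps: once `y = 0` on `[0, ka]`, the delayed term vanishes up to `(k + 1)a`, so both
`y₁ ± i y₂` vanish there. -/
theorem IsSolution.eq_zero (ha : 0 < a) (hq : IsPotential a q) (hp : IsPotential a p)
    {y : ℝ → Fin 2 → ℂ} (hy : IsSolution a q p z y) (h0 : y 0 = 0) :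
    ∀ x ∈ Icc 0 Real.pi, y x = 0 := by
  have key : ∀ k : ℕ, ∀ x ∈ Icc 0 Real.pi, x ≤ k * a → y x = 0 := by
    intro k
    induction k with
    | zero =>
      intro x hx hxk
      have : x = 0 := le_antisymm (by simpa using hxk) hx.1
      rw [this, h0]
    | succ k ih =>
      intro x hx hxk
      have hQ : ∀ᵐ t, t ∈ Ioo 0 x → (Q q p t).mulVec (y (t - a)) = 0 := by
        filter_upwards [ae_eq_zero_of_isPotential hq, ae_eq_zero_of_isPotential hp] with t h1 h2 ht
        rcases le_or_gt t a with h | h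
        · have h3 : Q q p t = 0 := by
            ext i j
            fin_cases i <;> fin_cases j <;> simp [Q, h1 ⟨ht.1.le, h⟩, h2 ⟨ht.1.le, h⟩]
          rw [h3, Matrix.zero_mulVec]
        · rw [ih (t - a) ⟨by linarith, by linarith [ht.2, hx.2]⟩ ?_, Matrix.mulVec_zero]
          push_cast at hxk
          linarith [ht.2]
      have e1 := hy.add_mul_eq_zero h0 hx.1 hx.2 hQ Complex.I_sq x ⟨hx.1, le_rfl⟩
      have e2 := hy.add_mul_eq_zero h0 hx.1 hx.2 hQ (σ := -Complex.I)
        (by rw [neg_sq, Complex.I_sq]) x ⟨hx.1, le_rfl⟩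
      ext i
      fin_cases i
      · show y x 0 = 0
        linear_combination (e1 + e2) / 2
      · show y x 1 = 0
        have : Complex.I * y x 1 = 0 := by linear_combination (e1 - e2) / 2
        exact (mul_eq_zero.1 this).resolve_left Complex.I_ne_zero
  intro x hx
  obtain ⟨k, hk⟩ := exists_nat_ge (x / a)
  exact key k x hx ((div_le_iff₀ ha).1 hk)

end

/-! ### Characteristic functions as perturbed sines. -/

section

variable {a : ℝ} {q p : ℝ → ℂ}

theorem delayOp_freeExp_pi (a : ℝ) (z : ℂ) (r : ℝ → ℂ) (d : ℂ) :
    delayOp a z r (freeExp (-z) d) Real.pi =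
      d * ∫ t in Ioc 0 Real.pi,
        r t * Complex.exp (Complex.I * z * (Real.pi + a - 2 * t : ℝ)) := by
  rw [delayOp, intervalIntegral.integral_of_le Real.pi_pos.le, ← integral_const_mul,
    ← integral_const_mul]
  congr 1 with t
  have h : Complex.exp (Complex.I * z * (Real.pi + a - 2 * t : ℝ))
      = Complex.exp (Complex.I * z * Real.pi) * Complex.exp (-(Complex.I * z * t)) *
        Complex.exp (Complex.I * -z * (t - a : ℝ)) := by
    rw [← Complex.exp_add, ← Complex.exp_add]
    congr 1
    push_cast
    ring
  rw [h, freeExp]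
  ring

theorem delayOp_delayOp_freeExp_pi {r : ℝ → ℂ} (hr0 : ∀ t ≤ a, r t = 0) (z : ℂ) (s : ℝ → ℂ)
    (c : ℂ) :
    delayOp a z r (delayOp a (-z) s (freeExp z c)) Real.pi =
      c * ∫ t in Ioc 0 Real.pi, r t * Complex.exp (Complex.I * z * (Real.pi - 2 * t : ℝ)) *
        ∫ τ in Ioc 0 (t - a), s τ * Complex.exp (Complex.I * z * (2 * τ : ℝ)) := by
  rw [delayOp, intervalIntegral.integral_of_le Real.pi_pos.le, ← integral_const_mul,
    ← integral_const_mul]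
  congr 1 with t
  rcases le_or_gt t a with h | h
  · rw [hr0 t h]; ring
  rw [delayOp, intervalIntegral.integral_of_le (by linarith)]
  have h1 : ∫ τ in Ioc 0 (t - a), Complex.exp (-(Complex.I * -z * τ)) *
      (s τ * freeExp z c (τ - a)) = c * Complex.exp (-(Complex.I * z * a)) *
        ∫ τ in Ioc 0 (t - a), s τ * Complex.exp (Complex.I * z * (2 * τ : ℝ)) := by
    rw [← integral_const_mul]
    congr 1 with τ
    have h2 : Complex.exp (-(Complex.I * z * a)) * Complex.exp (Complex.I * z * (2 * τ : ℝ))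
        = Complex.exp (-(Complex.I * -z * τ)) * Complex.exp (Complex.I * z * (τ - a : ℝ)) := by
      rw [← Complex.exp_add, ← Complex.exp_add]
      congr 1
      push_cast
      ring
    rw [freeExp]
    linear_combination (-(c * s τ)) * h2
  rw [h1]
  have h3 : Complex.exp (Complex.I * z * (Real.pi - 2 * t : ℝ))
      = Complex.exp (Complex.I * z * Real.pi) * Complex.exp (-(Complex.I * z * t)) *
        (Complex.exp (Complex.I * -z * (t - a : ℝ)) * Complex.exp (-(Complex.I * z * a))) := by
    rw [← Complex.exp_add, ← Complex.exp_add, ← Complex.exp_add]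
    congr 1
    push_cast
    ring
  rw [h3]
  ring

theorem exists_diagSol_pi_eq (ha : 0 < a) (haπ : a < Real.pi) (hq : IsPotential a q)
    (hp : IsPotential a p) (σ₁ σ₂ c d : ℂ) :
    ∃ R, IsSineRemainder R ∧ ∀ z, diagSol a z (diagPot a q p σ₁) (diagPot a q p σ₂) c d Real.pi =
      Complex.exp (Complex.I * z * Real.pi) * c + R z := by
  have h₁ := isSineRemainder_fourierIntegral (w := diagPot a q p σ₁) (d := Real.pi + a)
    -- For `t ∈ (a, π]` the frequency `π + a - 2t` lies in `[a - π, π - a]`.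
    (b := Real.pi - a) ((memLp_diagPot ha hq hp σ₁).restrict _) (by linarith) (fun t _ h0 => by
      have ht : t ∈ Ioc a Real.pi := by
        by_contra hcon
        exact h0 (diagPot_of_notMem hcon)
      rw [abs_le]
      exact ⟨by linarith [ht.2], by linarith [ht.1]⟩)
  have h₂ := isSineRemainder_iterated ha haπ (memLp_diagPot ha hq hp σ₁)
    (memLp_diagPot ha hq hp σ₂) (integrable_diagPot ha hq hp σ₁) (integrable_diagPot ha hq hp σ₂)
    (fun t ht => diagPot_of_notMem ht) (fun t ht => diagPot_of_notMem ht)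
  refine ⟨_, (h₁.const_mul d).add (h₂.const_mul c), fun z => ?_⟩
  rw [diagSol, delayOp_freeExp_pi, delayOp_delayOp_freeExp_pi (fun t ht => diagPot_of_le ht),
    freeExp]
  ring

/-- The fundamental matrix-solution. -/
def fundMatrix (a : ℝ) (q p : ℝ → ℂ) (z : ℂ) (x : ℝ) : Matrix (Fin 2) (Fin 2) ℂ :=
  -- The pairs `(1, 1)` and `(i, -i)` are the values of `(y₁ + i y₂, y₁ - i y₂)` at the two unit
  -- vectors.
  Matrix.of fun i k => vecSol a q p z ((![1, Complex.I] : Fin 2 → ℂ) k)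
    ((![1, -Complex.I] : Fin 2 → ℂ) k) x i

theorem isFundamentalMatrix_fundMatrix (ha : 0 < a) (ha3 : Real.pi < 3 * a)
    (hq : IsPotential a q) (hp : IsPotential a p) (z : ℂ) :
    IsFundamentalMatrix a q p z (fundMatrix a q p z) := by
  refine ⟨fun k => isSolution_vecSol ha ha3 hq hp _ _, ?_⟩
  ext i k
  have hI := Complex.I_ne_zero
  fin_cases i <;> fin_cases k <;> simp [fundMatrix, vecSol, diagSol_zero]
  field_simp
  norm_num

/-- By uniqueness, a solution with `y_ν(0) = 0` is a multiple of column `ν.rev` of `Y`, by a nonzero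
factor if it is nontrivial. -/
theorem isEigenvalue_iff {z : ℂ} (ha : 0 < a) (hq : IsPotential a q) (hp : IsPotential a p)
    {Y : ℝ → Matrix (Fin 2) (Fin 2) ℂ} (hY : IsFundamentalMatrix a q p z Y) (ν j : Fin 2) :
    IsEigenvalue a q p ν j z ↔ Y Real.pi j ν.rev = 0 := by
  have hrev : ∀ i : Fin 2, i ≠ ν → i = ν.rev := by
    intro i hi
    fin_cases ν <;> fin_cases i <;> simp_all
  have hne : ν ≠ ν.rev := by fin_cases ν <;> simp
  constructor
  · rintro ⟨y, hy, hν, hj, x, hx, hxy⟩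
    have hsol := hy.sub ((hY.1 ν.rev).const_smul (y 0 ν.rev))
    have hzero := hsol.eq_zero ha hq hp (by
      ext i
      simp only [hY.2, Pi.sub_apply, Pi.smul_apply, smul_eq_mul, Pi.zero_apply]
      by_cases hi : i = ν
      · subst hi
        rw [hν, Matrix.one_apply_ne hne]; simp
      · rw [hrev i hi, Matrix.one_apply_eq]; simp)
    have hc : y 0 ν.rev ≠ 0 := by
      intro hc
      have := hzero x hx
      simp only [hc, zero_smul, sub_zero] at this
      exact hxy this
    have hπ := congrFun (hzero Real.pi ⟨Real.pi_pos.le, le_rfl⟩) j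
    simp only [Pi.sub_apply, Pi.smul_apply, smul_eq_mul, Pi.zero_apply, hj, zero_sub,
      neg_eq_zero] at hπ
    exact (mul_eq_zero.1 hπ).resolve_left hc
  · intro h
    refine ⟨_, hY.1 ν.rev, ?_, h, 0, ⟨le_rfl, Real.pi_pos.le⟩, fun h0 => ?_⟩
    · rw [hY.2, Matrix.one_apply_ne hne]
    · have := congrFun h0 ν.rev
      rw [hY.2] at this
      simp at this

/-- The entries of the fundamental matrix-solution at `π` are, after a shift of the spectral
parameter and up to sign, perturbations of `sin (π z)`. -/
theorem exists_fundMatrix_pi_eq (ha : 0 < a) (haπ : a < Real.pi) (hq : IsPotential a q)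
    (hp : IsPotential a p) (ν j : Fin 2) :
    ∃ (ε : ℂ) (g : ℂ → ℂ) (σ : ℝ), ε ≠ 0 ∧ IsSineRemainder g ∧
      (σ : ℂ) = (2 - (((ν : ℕ) : ℂ) + 1) - (((j : ℕ) : ℂ) + 1)) / 2 ∧
      ∀ z, fundMatrix a q p z Real.pi j ν.rev =
        ε * (Complex.sin (Real.pi * (z - σ)) + g (z - σ)) := by
  obtain ⟨R, hR, hRe⟩ := exists_diagSol_pi_eq ha haπ hq hp (-Complex.I) Complex.I
    ((![1, Complex.I] : Fin 2 → ℂ) ν.rev) ((![1, -Complex.I] : Fin 2 → ℂ) ν.rev)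
  obtain ⟨S, hS, hSe⟩ := exists_diagSol_pi_eq ha haπ hq hp Complex.I (-Complex.I)
    ((![1, -Complex.I] : Fin 2 → ℂ) ν.rev) ((![1, Complex.I] : Fin 2 → ℂ) ν.rev)
  have hI0 := Complex.I_ne_zero
  have hI := Complex.I_sq
  have hneg : ∀ z : ℂ, Complex.exp (Complex.I * -z * Real.pi)
      = Complex.exp (-(Real.pi * z) * Complex.I) := fun z => by congr 1; ring
  have hpos : ∀ z : ℂ, Complex.exp (Complex.I * z * Real.pi)
      = Complex.exp (Real.pi * z * Complex.I) := fun z => by congr 1; ring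
  have hsin : ∀ w : ℂ, Complex.sin w =
      (Complex.exp (-w * Complex.I) - Complex.exp (w * Complex.I)) * Complex.I / 2 := fun _ => rfl
  have hcos : ∀ w : ℂ, Complex.cos w =
      (Complex.exp (w * Complex.I) + Complex.exp (-w * Complex.I)) / 2 := fun _ => rfl
  have hshift : ∀ z : ℂ, Complex.sin (Real.pi * (z - ((-(1 / 2) : ℝ) : ℂ))) =
      Complex.cos (Real.pi * z) := fun z => by
    rw [← Complex.sin_add_pi_div_two]
    congr 1
    push_cast
    ring
  have hshift' : ∀ z : ℂ, Complex.sin (Real.pi * (z - ((-1 : ℝ) : ℂ))) =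
      -Complex.sin (Real.pi * z) := fun z => by
    rw [← Complex.sin_add_pi]
    congr 1
    push_cast
    ring
  have hplus : ∀ (k₁ k₂ : ℂ) (σ : ℝ),
      IsSineRemainder fun z => k₁ * R (z + σ) + k₂ * S (-(z + σ)) := fun k₁ k₂ σ =>
    ((hR.const_mul k₁).add (hS.comp_neg.const_mul k₂)).comp_add_real σ
  -- The unperturbed entries are `-sin πz`, `cos πz`, `cos πz`, `sin πz`. The shifts `0, -1/2, -1/2,
  -- -1` turn them into `±sin (π(z - σ))` with the `σ` demanded by the numbering; `ε` carries the
  -- sign.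
  fin_cases ν <;> fin_cases j
  · refine ⟨-1, _, 0, by norm_num, hplus (-(1 / 2)) (-(1 / 2)) 0, by norm_num, fun z => ?_⟩
    simp [fundMatrix, vecSol] at hRe hSe ⊢
    rw [hRe, hSe, hneg, hpos, hsin]
    ring
  · refine ⟨1, _, -(1 / 2), by norm_num, hplus (1 / (2 * Complex.I)) (-(1 / (2 * Complex.I)))
      (-(1 / 2)), by norm_num, fun z => ?_⟩
    rw [hshift]
    simp [fundMatrix, vecSol] at hRe hSe ⊢
    rw [hRe, hSe, hneg, hpos, hcos]
    field_simp
    ring_nf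
    simp only [hI]
    ring
  · refine ⟨1, _, -(1 / 2), by norm_num, hplus (1 / 2) (1 / 2) (-(1 / 2)), by norm_num,
      fun z => ?_⟩
    rw [hshift]
    simp [fundMatrix, vecSol] at hRe hSe ⊢
    rw [hRe, hSe, hneg, hpos, hcos]
    ring
  · refine ⟨-1, _, -1, by norm_num, hplus (-(1 / (2 * Complex.I))) (1 / (2 * Complex.I))
      (-1), by norm_num, fun z => ?_⟩
    rw [hshift']
    simp [fundMatrix, vecSol] at hRe hSe ⊢
    rw [hRe, hSe, hneg, hpos, hsin]
    field_simp
    ring_nf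
    simp only [hI]
    ring

end

end DiracDelay

end

theorem theorem1 (a : ℝ) (ha₁ : 2 * Real.pi / 5 ≤ a) (ha₂ : a < Real.pi / 2)
    (q p : ℝ → ℂ) (hq : DiracDelay.IsPotential a q) (hp : DiracDelay.IsPotential a p)
    (ν j : Fin 2) :
    {z : ℂ | DiracDelay.IsEigenvalue a q p ν j z}.Infinite ∧
    ∃ Δ : ℂ → ℂ, DiracDelay.IsCharacteristicFunction a q p ν j Δ ∧ Differentiable ℂ Δ ∧
      ∃ lam κ : ℤ → ℂ,
        Set.range lam = {z : ℂ | DiracDelay.IsEigenvalue a q p ν j z} ∧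
        (∀ z : ℂ, {n : ℤ | lam n = z}.encard = analyticOrderAt Δ z) ∧
        (∀ n : ℤ, lam n =
          (n : ℂ) + (2 - (((ν : ℕ) : ℂ) + 1) - (((j : ℕ) : ℂ) + 1)) / 2 + κ n) ∧
        Memℓp κ 2 := by
  have hπ := Real.pi_pos
  have ha : 0 < a := by linarith
  have ha3 : Real.pi < 3 * a := by linarith
  have hfund := DiracDelay.isFundamentalMatrix_fundMatrix ha ha3 hq hp
  obtain ⟨ε, g, σ, hε, hg, hσ, hΔ⟩ :=
    DiracDelay.exists_fundMatrix_pi_eq ha (by linarith) hq hp ν j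
  set f : ℂ → ℂ := fun z => Complex.sin (Real.pi * z) + g z with hf
  have hfd : Differentiable ℂ f := DiracDelay.differentiable_sin_pi.add hg.differentiable
  set Δ : ℂ → ℂ := fun z => DiracDelay.fundMatrix a q p z Real.pi j ν.rev with hΔdef
  have hΔf : Δ = (fun _ => ε) * (f ∘ fun z => z - σ) := funext hΔ
  have hΔd : Differentiable ℂ Δ := by
    rw [hΔf]
    exact (differentiable_const ε).mul (hfd.comp (differentiable_id.sub_const _))
  have horder : ∀ z, analyticOrderAt Δ z = analyticOrderAt f (z - σ) := by
    intro z
    have hs : AnalyticAt ℂ (fun z : ℂ => z - σ) z := by fun_prop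
    -- Neither a nonzero constant factor nor a translation of the variable changes the order of a
    -- zero.
    rw [hΔf, analyticOrderAt_mul analyticAt_const ((hfd.analyticAt _).comp hs),
      (analyticAt_const (v := ε)).analyticOrderAt_eq_zero.2 hε, zero_add,
      analyticOrderAt_comp_of_deriv_ne_zero hs (by simp)]
  have heig : ∀ z, DiracDelay.IsEigenvalue a q p ν j z ↔ Δ z = 0 := fun z =>
    DiracDelay.isEigenvalue_iff ha hq hp (hfund z) ν j
  obtain ⟨htop, lam, κ, hmult, hlam, hκ⟩ := DiracDelay.exists_zero_enumeration hg (f := f) fun _ => rfl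
  have hmult' : ∀ z : ℂ, {n : ℤ | lam n + σ = z}.encard = analyticOrderAt Δ z := by
    intro z
    rw [horder, ← hmult]
    simp only [eq_sub_iff_add_eq]
  have hrange : Set.range (fun n => lam n + σ) =
      {z : ℂ | DiracDelay.IsEigenvalue a q p ν j z} := by
    ext z
    rw [Set.mem_ofPred_eq, heig, Set.mem_range]
    have h1 : Δ z = 0 ↔ analyticOrderAt Δ z ≠ 0 := by
      rw [(hΔd.analyticAt z).analyticOrderAt_ne_zero]
    rw [h1, ← hmult' z, Set.encard_ne_zero]
    rfl
  refine ⟨?_, Δ, fun z => ⟨_, hfund z, rfl⟩, hΔd, fun n => lam n + σ, κ, hrange, hmult',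
    fun n => ?_, hκ⟩
  · rw [← hrange]
    -- Multiplicities are finite, so a finite set of eigenvalues would make `ℤ` a finite union of
    -- finite fibres.
    have hfib : ∀ z : ℂ, {n : ℤ | lam n + σ = z}.Finite := by
      intro z
      rw [← Set.encard_lt_top_iff, hmult', horder]
      exact (htop _).lt_top
    intro hfin
    refine Set.infinite_univ (α := ℤ) ?_
    refine (hfin.biUnion fun z _ => hfib z).subset fun n _ => ?_
    exact Set.mem_biUnion (Set.mem_range_self n) rfl
  · rw [← hσ]
    show lam n + σ = _
    rw [hlam]
    ring
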